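/- Let $0<s<1$, $G_s=\{z\in\mathbb C: s<|z|<1\}$, $\partial G_s=s\mathbb T\cup\mathbb T$, where $\mathbb T$ is the unit circle, and let $\mu$ be angular measure on $\partial G_s$ normalized so that each of the two circles has mass $1$. For $k\in\mathbb N$ let $H^{k,\infty}(G_s)$ be the space of analytic functions $f$ on $G_s$ such that $f^{(i)}$ is bounded on $G_s$ for $0\le i\le k$. Such derivatives are identified with their boundary functions on $\partial G_s$, given $\mu$-a.e. by radial limits. For $E\subseteq\partial G_s$ put $$\|f\|_{H^{k,\infty}(E)}=\max_{0\le i\le k}\Big(\|f^{(i)}\|_{L^\infty(E\cap s\mathbb T)}+\|f^{(i)}\|_{L^\infty(E\cap\mathbb T)}\Big),\qquad \|f\|_{H^{k,\infty}(G_s)}=\|f\|_{H^{k,\infty}(\partial G_s)}.$$ For a nonempty connected relatively open set $I\subseteq\partial G_s$ put $\lambda=\mu(I)\in(0,1]$ and $\|f\|_{L^1(I)}=\frac1\lambda\int_I|f|\,d\mu$. Let $$q_0=-\log s,\qquad C_s=\inf_{|t|\le\pi}\frac1{2q_0}\sum_{n\in\mathbb Z}\frac1{1+\cosh\left(\frac{\pi}{q_0}(t+2\pi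 n)\right)}.$$ **Corollary 3.8.** Let $K>0$ and let $0\le j<k$ be integers. There exist constants $C,\varepsilon>0$ depending only on $K,k,j,s$ and $\lambda$ such that for every $I$ as above with $\mu(I)=\lambda$ and every $f\in H^{k,\infty}(G_s)$ with $$\|f\|_{H^{k,\infty}(G_s)}\le K,\qquad \|f\|_{H^{j,\infty}(I)}<e^{-q_0/(\lambda C_s)},\qquad \|f\|_{L^1(I)}<\varepsilon,$$ one has $$\|f\|_{H^{j,\infty}(\partial G_s)}\le\frac{C}{\big|\log\|f\|_{L^1(I)}\big|^{k-j}},$$ where the right-hand side is read as $0$ if $\|f\|_{L^1(I)}=0$. -/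

import Mathlib

open MeasureTheory Filter Topology
open scoped ENNReal

noncomputable section

namespace AnnulusHardy

/-- The annulus `G_s = {z : s < |z| < 1}`. -/
def annulus (s : ℝ) : Set ℂ := {z | s < ‖z‖ ∧ ‖z‖ < 1}

/-- The boundary `∂G_s`, the union of the circles of radius `s` and `1` about `0`. -/
def bdry (s : ℝ) : Set ℂ := Metric.sphere 0 s ∪ Metric.sphere 0 1

/-- Normalized angular measure `dθ / (2π)` on the circle of radius `r` about `0`. -/
def circleMeasure (r : ℝ) : Measure ℂ :=
  Measure.map (circleMap 0 r)
    (ENNReal.ofReal (1 / (2 * Real.pi)) • volume.restrict (Set.Ioc 0 (2 * Real.pi)))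

/-- The measure `μ` on `∂G_s` for which each of the two circles has mass one. -/
def bdryMeasure (s : ℝ) : Measure ℂ := circleMeasure s + circleMeasure 1

/-- `f` belongs to `H^∞(G_s)`: it is analytic and bounded on the annulus. -/
def MemHardy (s : ℝ) (f : ℂ → ℂ) : Prop :=
  DifferentiableOn ℂ f (annulus s) ∧ ∃ M : ℝ, ∀ z ∈ annulus s, ‖f z‖ ≤ M

/-- `f` belongs to `H^{k,∞}(G_s)`: all complex derivatives of order at most `k` are in
`H^∞(G_s)`. -/
def MemHardySobolev (s : ℝ) (k : ℕ) (f : ℂ → ℂ) : Prop :=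
  ∀ i ≤ k, MemHardy s (iteratedDeriv i f)

/-- The boundary function of `f`: its radial limit from inside `G_s` at `ζ ∈ ∂G_s`.
For `f ∈ H^∞(G_s)` this limit exists at almost every `ζ`. -/
def bdryValue (s : ℝ) (f : ℂ → ℂ) (ζ : ℂ) : ℂ :=
  limUnder (𝓝[{r : ℝ | (r : ℂ) * ζ ∈ annulus s}] (1 : ℝ)) (fun r : ℝ => f ((r : ℂ) * ζ))

/-- The norm of `L^∞(E)`, for `E ⊆ ∂G_s`, of the boundary function of `f`. -/
def supNorm (s : ℝ) (E : Set ℂ) (f : ℂ → ℂ) : ℝ≥0∞ :=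
  eLpNorm (bdryValue s f) ∞ ((bdryMeasure s).restrict E)

/-- The norm of `H^{k,∞}(E)`, for `E ⊆ ∂G_s`: the maximum over `0 ≤ i ≤ k` of the sum of
the sup norms of `f^{(i)}` over the parts of `E` on the inner and on the outer circle.
With `E = ∂G_s` it is the norm of `H^{k,∞}(G_s)`. -/
def hardySobolevNorm (s : ℝ) (k : ℕ) (E : Set ℂ) (f : ℂ → ℂ) : ℝ≥0∞ :=
  (Finset.range (k + 1)).sup fun i =>
    supNorm s (E ∩ Metric.sphere 0 s) (iteratedDeriv i f) +
      supNorm s (E ∩ Metric.sphere 0 1) (iteratedDeriv i f)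

/-- The normalized `L^1(I)` norm `(1 / (2πλ)) ∫_I |f(r e^{iθ})| dθ`, where `2πλ` is the angular
length of `I`, i.e. the mean of `|f|` over `I` for the measure `μ`. -/
def l1Norm (s : ℝ) (I : Set ℂ) (f : ℂ → ℂ) : ℝ :=
  ((bdryMeasure s) I).toReal⁻¹ * ∫ ζ in I, ‖bdryValue s f ζ‖ ∂(bdryMeasure s)

/-- `q₀ = - log s`. -/
def q0 (s : ℝ) : ℝ := -Real.log s

/-- `C_s = inf_{|t| ≤ π} (1 / (2 q₀)) ∑_{n ∈ ℤ} 1 / (1 + cosh (π (t + 2πn) / q₀))`. -/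
def kernelConst (s : ℝ) : ℝ :=
  ⨅ t : Set.Icc (-Real.pi) Real.pi,
    1 / (2 * q0 s) *
      ∑' n : ℤ, 1 / (1 + Real.cosh (Real.pi / q0 s * ((t : ℝ) + 2 * Real.pi * (n : ℝ))))

end AnnulusHardy

end

/-!
The boundary norm bounds the derivatives of `f` up to order `k` inside the annulus: apply the
maximum principle to a lower derivative, which extends continuously to the closure, and Fatou's
theorem to the top one. Now suppose that the mean of `|f|` over an arc is at most `exp (-L)`. Since
`f` is Lipschitz, `|f| ≤ exp (-L / 4)` on a part of the arc. Let `m` be the supremum of `|f|`. If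
`m ≥ exp (-L / 8)`, the two-constants theorem gives `|f| ≤ m * exp (-c * t * L)` at distance `t`
from the boundary. By Kolmogorov's inequality `|f'|` is of order `m ^ ((k - 1) / k)`, so a point
where `|f|` is nearly `m` can be moved radially by a distance `t` of order `m ^ (1 / k)` without
halving `|f|`. Hence `t * L` is bounded, that is, `m` is of order `L ^ (-k)`, and Kolmogorov's
inequality bounds the derivative of order `i` by a multiple of `L ^ (i - k)`.
-/

namespace AnnulusHardy

open Set Metric

section Kolmogorov

variable {E : Type*} [NormedAddCommGroup E] [NormedSpace ℝ E]

theorem exists_norm_coeff_le (n : ℕ) : ∃ B > 0, ∀ (c : ℕ → E) (N : ℝ),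
    (∀ x ∈ Icc (0 : ℝ) 1, ‖∑ i ∈ Finset.range (n + 1), x ^ i • c i‖ ≤ N) →
      ∀ i ≤ n, ‖c i‖ ≤ B * N := by
  set v : Fin (n + 1) → ℝ := fun j => j / (n + 1)
  set V := Matrix.vandermonde v
  have hv : ∀ j, v j ∈ Icc (0 : ℝ) 1 := fun j =>
    ⟨by positivity, div_le_one_of_le₀ (by exact_mod_cast j.is_lt.le) (by positivity)⟩
  have hinj : Function.Injective v := fun i j hij => by
    have := (div_left_inj' (by positivity : (n + 1 : ℝ) ≠ 0)).mp hij
    exact Fin.ext (by exact_mod_cast this)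
  have hV : V⁻¹ * V = 1 := Matrix.nonsing_inv_mul _
    (isUnit_iff_ne_zero.mpr (Matrix.det_vandermonde_ne_zero_iff.mpr hinj))
  refine ⟨1 + ∑ i, ∑ j, |V⁻¹ i j|, by positivity, fun c N hN i hi => ?_⟩
  have hN0 : 0 ≤ N := (norm_nonneg _).trans (hN 0 (by simp))
  set i' : Fin (n + 1) := ⟨i, Nat.lt_succ_of_le hi⟩
  have hc : c i = ∑ j, V⁻¹ i' j • ∑ l ∈ Finset.range (n + 1), v j ^ l • c l := by
    calc c i = ∑ l, (V⁻¹ * V) i' l • c l := by simp [hV, Matrix.one_apply, i']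
      _ = ∑ j, V⁻¹ i' j • ∑ l : Fin (n + 1), v j ^ (l : ℕ) • c l := by
          simp only [Matrix.mul_apply, Finset.sum_smul, Finset.smul_sum, mul_smul]
          rw [Finset.sum_comm]
          rfl
      _ = _ := by simp only [Finset.sum_range]
  calc ‖c i‖ ≤ ∑ j, |V⁻¹ i' j| * N := by
        rw [hc]
        refine norm_sum_le_of_le _ fun j _ => ?_
        rw [norm_smul, Real.norm_eq_abs]
        exact mul_le_mul_of_nonneg_left (hN _ (hv j)) (abs_nonneg _)
    _ = (∑ j, |V⁻¹ i' j|) * N := (Finset.sum_mul ..).symm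
    _ ≤ (1 + ∑ i, ∑ j, |V⁻¹ i j|) * N := by
        gcongr
        have := Finset.single_le_sum (f := fun i => ∑ j, |V⁻¹ i j|)
          (fun _ _ => by positivity) (Finset.mem_univ i')
        linarith

theorem norm_taylorWithinEval_le {n : ℕ} {ℓ K N : ℝ} (hℓ : 0 ≤ ℓ) {φ : ℝ → E}
    (hφ : ContDiffOn ℝ (n + 1) φ (Icc 0 ℓ))
    (hK : ∀ y ∈ Icc 0 ℓ, ‖iteratedDerivWithin (n + 1) φ (Icc 0 ℓ) y‖ ≤ K)
    (hN : ∀ y ∈ Icc 0 ℓ, ‖φ y‖ ≤ N) {y : ℝ} (hy : y ∈ Icc 0 ℓ) :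
    ‖taylorWithinEval φ n (Icc 0 ℓ) 0 y‖ ≤ N + K * y ^ (n + 1) := by
  have hK0 : 0 ≤ K := (norm_nonneg _).trans (hK y hy)
  have hrem := taylor_mean_remainder_bound hℓ hφ hy hK
  rw [sub_zero] at hrem
  have hfact : K * y ^ (n + 1) / n.factorial ≤ K * y ^ (n + 1) :=
    div_le_self (by have := hy.1; positivity) (by exact_mod_cast n.factorial_pos)
  exact (norm_le_norm_add_norm_sub _ _).trans (add_le_add (hN y hy) (hrem.trans hfact))

theorem exists_pow_mul_norm_iteratedDerivWithin_le (n : ℕ) :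
    ∃ B > 0, ∀ (ℓ K N : ℝ) (φ : ℝ → E), ContDiffOn ℝ (n + 1) φ (Icc 0 ℓ) →
      (∀ y ∈ Icc 0 ℓ, ‖iteratedDerivWithin (n + 1) φ (Icc 0 ℓ) y‖ ≤ K) →
      (∀ y ∈ Icc 0 ℓ, ‖φ y‖ ≤ N) → ∀ T ∈ Icc 0 ℓ, ∀ i ≤ n,
        T ^ i * ‖iteratedDerivWithin i φ (Icc 0 ℓ) 0‖ ≤ B * (N + K * T ^ (n + 1)) := by
  obtain ⟨B, hB, hcoeff⟩ := exists_norm_coeff_le (E := E) n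
  refine ⟨n.factorial * B, by positivity, fun ℓ K N φ hφ hK hN T hT i hi => ?_⟩
  have hT0 := hT.1
  have hℓ : 0 ≤ ℓ := hT.1.trans hT.2
  have hK0 : 0 ≤ K := (norm_nonneg _).trans (hK T hT)
  have hN0 : 0 ≤ N := (norm_nonneg _).trans (hN T hT)
  set D : ℕ → E := fun l => iteratedDerivWithin l φ (Icc 0 ℓ) 0
  have hpoly : ∀ x ∈ Icc (0 : ℝ) 1, ‖∑ l ∈ Finset.range (n + 1),
      x ^ l • ((l.factorial : ℝ)⁻¹ * T ^ l) • D l‖ ≤ N + K * T ^ (n + 1) := fun x hx => by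
    have hx0 := hx.1
    have hxT : x * T ≤ T := mul_le_of_le_one_left hT.1 hx.2
    have htaylor := norm_taylorWithinEval_le hℓ hφ hK hN
      (y := x * T) ⟨by positivity, hxT.trans hT.2⟩
    rw [taylor_within_apply] at htaylor
    calc _ = ‖∑ l ∈ Finset.range (n + 1), ((l.factorial : ℝ)⁻¹ * (x * T - 0) ^ l) • D l‖ := by
          congr 1
          exact Finset.sum_congr rfl fun l _ => by rw [smul_smul]; ring_nf
      _ ≤ N + K * (x * T) ^ (n + 1) := htaylor
      _ ≤ N + K * T ^ (n + 1) := by gcongr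
  have hDi := hcoeff _ _ hpoly i hi
  rw [norm_smul, Real.norm_of_nonneg (by positivity)] at hDi
  calc T ^ i * ‖D i‖ = i.factorial * ((i.factorial : ℝ)⁻¹ * T ^ i * ‖D i‖) := by field_simp
    _ ≤ i.factorial * (B * (N + K * T ^ (n + 1))) := by gcongr
    _ ≤ n.factorial * (B * (N + K * T ^ (n + 1))) := by gcongr
    _ = n.factorial * B * (N + K * T ^ (n + 1)) := (mul_assoc ..).symm

theorem exists_norm_iteratedDerivWithin_le (n : ℕ) {ℓ η₀ : ℝ} (hℓ : 0 < ℓ) (hη₀ : 0 < η₀)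
    (K : ℝ) : ∃ A > 0, ∀ φ : ℝ → E, ContDiffOn ℝ (n + 1) φ (Icc 0 ℓ) →
      (∀ y ∈ Icc 0 ℓ, ‖iteratedDerivWithin (n + 1) φ (Icc 0 ℓ) y‖ ≤ K) →
      ∀ η, 0 < η → η ≤ η₀ → (∀ y ∈ Icc 0 ℓ, ‖φ y‖ ≤ η ^ (n + 1)) →
        ∀ i ≤ n, ‖iteratedDerivWithin i φ (Icc 0 ℓ) 0‖ ≤ A * η ^ (n + 1 - i) := by
  obtain ⟨B, hB, hBφ⟩ := exists_pow_mul_norm_iteratedDerivWithin_le (E := E) n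
  set σ := min 1 (ℓ / η₀)
  have hσ : 0 < σ := by positivity
  have hσ1 : σ ≤ 1 := min_le_left _ _
  refine ⟨B * (1 + |K|) / σ ^ n, by positivity, fun φ hφ hK η hη hηη₀ hφη i hi => ?_⟩
  have hTη : σ * η ≤ η := mul_le_of_le_one_left hη.le hσ1
  have hTℓ : σ * η ≤ ℓ := calc
    σ * η ≤ ℓ / η₀ * η₀ := by gcongr; exact min_le_right _ _
    _ = ℓ := div_mul_cancel₀ _ hη₀.ne'
  have hbound := hBφ ℓ K _ φ hφ hK hφη (σ * η) ⟨by positivity, hTℓ⟩ i hi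
  calc ‖iteratedDerivWithin i φ (Icc 0 ℓ) 0‖
      ≤ B * (η ^ (n + 1) + K * (σ * η) ^ (n + 1)) / (σ * η) ^ i := by
        rwa [le_div_iff₀' (by positivity)]
    _ ≤ B * (η ^ (n + 1) + |K| * η ^ (n + 1)) / (σ * η) ^ i := by
        gcongr
        exact le_abs_self K
    _ = B * (1 + |K|) / σ ^ i * η ^ (n + 1 - i) := by
        rw [mul_pow, ← pow_mul_pow_sub η (hi.trans n.le_succ)]
        field_simp
    _ ≤ B * (1 + |K|) / σ ^ n * η ^ (n + 1 - i) := by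
        have := pow_le_pow_of_le_one hσ.le hσ1 hi
        gcongr

end Kolmogorov

section Strip

theorem norm_le_of_forall_re_eq {a b m C : ℝ} {Φ : ℂ → ℂ}
    (hΦ : DiffContOnCl ℂ Φ (Complex.re ⁻¹' Ioo a b))
    (hm : ∀ v : ℂ, v.re ∈ Icc a b → ‖Φ v‖ ≤ m)
    (ha : ∀ v : ℂ, v.re = a → ‖Φ v‖ ≤ C) (hb : ∀ v : ℂ, v.re = b → ‖Φ v‖ ≤ C)
    {v : ℂ} (hv : v.re ∈ Icc a b) : ‖Φ v‖ ≤ C := by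
  rcases (hv.1.trans hv.2).eq_or_lt with hab | hab
  · exact ha v (le_antisymm (hab ▸ hv.2) hv.1)
  refine PhragmenLindelof.vertical_strip hΦ ⟨0, by have := sub_pos.mpr hab; positivity, 0, ?_⟩
    ha hb hv.1 hv.2
  refine Asymptotics.IsBigO.of_bound m ?_
  filter_upwards [mem_inf_of_right (mem_principal_self _)] with w hw
  simpa using hm w (Ioo_subset_Icc_self hw)

/-- A holomorphic function on the strip `0 < re v < q` whose imaginary part is concentrated, as
`τ → 0`, near the boundary point `0`: it is `-1 / (Z - 1 + iτ)` for the conformal map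
`Z = exp (iπv / q)` onto the upper half plane. -/
noncomputable def stripPole (q τ : ℝ) (v : ℂ) : ℂ :=
  -1 / (Complex.exp (↑(Real.pi / q) * v * Complex.I) - 1 + τ * Complex.I)

variable {q τ : ℝ} {v : ℂ}

theorem im_stripPole (q τ : ℝ) (v : ℂ) :
    (stripPole q τ v).im =
      (Real.exp (-(Real.pi / q * v.im)) * Real.sin (Real.pi / q * v.re) + τ) /
        ((Real.exp (-(Real.pi / q * v.im)) * Real.cos (Real.pi / q * v.re) - 1) ^ 2 +
          (Real.exp (-(Real.pi / q * v.im)) * Real.sin (Real.pi / q * v.re) + τ) ^ 2) := by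
  rw [stripPole, Complex.div_im, Complex.normSq_apply]
  simp only [Complex.add_im, Complex.sub_im, Complex.add_re, Complex.sub_re, Complex.exp_re,
    Complex.exp_im, Complex.mul_re, Complex.mul_im, Complex.ofReal_re, Complex.ofReal_im,
    Complex.I_re, Complex.I_im, Complex.one_re, Complex.one_im, Complex.neg_re, Complex.neg_im]
  ring_nf

theorem sin_nonneg_of_mem_strip (hq : 0 < q) (hv : v.re ∈ Icc 0 q) :
    0 ≤ Real.sin (Real.pi / q * v.re) := by
  apply Real.sin_nonneg_of_nonneg_of_le_pi
  · have := hv.1; positivity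
  · calc Real.pi / q * v.re ≤ Real.pi / q * q := by gcongr; exact hv.2
      _ = Real.pi := div_mul_cancel₀ _ hq.ne'

theorem diffContOnCl_stripPole (hq : 0 < q) (hτ : 0 < τ) :
    DiffContOnCl ℂ (stripPole q τ) (Complex.re ⁻¹' Ioo 0 q) := by
  apply DifferentiableOn.diffContOnCl
  rw [Complex.closure_preimage_re, closure_Ioo hq.ne]
  intro v hv
  apply DifferentiableAt.differentiableWithinAt
  apply DifferentiableAt.div (by fun_prop) (by fun_prop)
  intro h
  have him := congr_arg Complex.im h
  have hsin := mul_nonneg (Real.exp_pos (-(Real.pi / q * v.im))).le (sin_nonneg_of_mem_strip hq hv)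
  have : Real.exp (-(Real.pi / q * v.im)) * Real.sin (Real.pi / q * v.re) + τ = 0 := by
    simpa [Complex.exp_im] using him
  linarith

theorem im_stripPole_le (hq : 0 < q) (hτ : 0 < τ) (hv : v.re ∈ Icc 0 q) :
    (stripPole q τ v).im ≤ 1 / τ := by
  have := sin_nonneg_of_mem_strip hq hv
  rw [im_stripPole]
  set x := Real.exp (-(Real.pi / q * v.im)) * Real.cos (Real.pi / q * v.re) - 1
  set y := Real.exp (-(Real.pi / q * v.im)) * Real.sin (Real.pi / q * v.re)
  have hy : 0 ≤ y := by positivity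
  rw [div_le_div_iff₀ (by positivity) hτ]
  nlinarith [sq_nonneg x]

theorem one_sub_exp_neg_sq_le {ρ y : ℝ} (hρ : 0 ≤ ρ) (hy : ρ ≤ |y|) :
    (1 - Real.exp (-ρ)) ^ 2 ≤ (Real.exp (-y) - 1) ^ 2 := by
  have hρ1 : Real.exp (-ρ) ≤ 1 := Real.exp_le_one_iff.mpr (by linarith)
  rcases le_abs.mp hy with h | h
  · have : Real.exp (-y) ≤ Real.exp (-ρ) := Real.exp_le_exp.mpr (by linarith)
    nlinarith
  · have : Real.exp ρ ≤ Real.exp (-y) := Real.exp_le_exp.mpr h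
    have : 1 + ρ ≤ Real.exp ρ := by linarith [Real.add_one_le_exp ρ]
    have : 1 - ρ ≤ Real.exp (-ρ) := by linarith [Real.add_one_le_exp (-ρ)]
    nlinarith

theorem im_stripPole_le_of_boundary {ρ : ℝ} (hq : 0 < q) (hρ : 0 < ρ) (hτ : 0 < τ)
    (hv : v.re = 0 ∧ ρ ≤ |v.im| ∨ v.re = q) :
    (stripPole q τ v).im ≤ τ / (1 - Real.exp (-(Real.pi / q * ρ))) ^ 2 := by
  have hp : 0 < Real.pi / q := by positivity
  have hη : 0 < 1 - Real.exp (-(Real.pi / q * ρ)) :=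
    sub_pos.mpr (Real.exp_lt_one_iff.mpr (neg_lt_zero.mpr (by positivity)))
  rw [im_stripPole]
  rcases hv with ⟨hre, him⟩ | hre
  · have hηle := one_sub_exp_neg_sq_le (ρ := Real.pi / q * ρ) (y := Real.pi / q * v.im)
      (by positivity) (by rw [abs_mul, abs_of_pos hp]; gcongr)
    simp only [hre, mul_zero, Real.cos_zero, Real.sin_zero, mul_one, zero_add]
    gcongr
    nlinarith
  · simp only [hre, div_mul_cancel₀ _ hq.ne', Real.cos_pi, Real.sin_pi, mul_zero, zero_add]
    gcongr
    nlinarith [Real.exp_pos (-(Real.pi / q * v.im)), Real.exp_pos (-(Real.pi / q * ρ))]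

theorem le_im_stripPole {R : ℝ} (hq : 0 < q) (hτ : 0 < τ) (hτ1 : τ ≤ 1) (hre : v.re = q / 2)
    (him : |v.im| ≤ R) :
    Real.exp (-(Real.pi / q * R)) / (1 + (Real.exp (Real.pi / q * R) + 1) ^ 2) ≤
      (stripPole q τ v).im := by
  have : 0 < Real.pi / q := by positivity
  have hhalf : Real.pi / q * (q / 2) = Real.pi / 2 := by field_simp
  rw [im_stripPole, hre, hhalf, Real.cos_pi_div_two, Real.sin_pi_div_two]
  have hlow : Real.exp (-(Real.pi / q * R)) ≤ Real.exp (-(Real.pi / q * v.im)) := by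
    gcongr
    exact (le_abs_self _).trans him
  have hupp : Real.exp (-(Real.pi / q * v.im)) ≤ Real.exp (Real.pi / q * R) := by
    rw [← mul_neg]
    gcongr
    exact (neg_le_abs _).trans him
  simp only [mul_zero, mul_one, zero_sub, neg_one_sq]
  gcongr
  linarith

theorem norm_mul_exp_stripPole (Φ : ℂ → ℂ) (l : ℝ) :
    ‖Φ v * Complex.exp (-(l * Complex.I) * stripPole q τ v)‖ =
      ‖Φ v‖ * Real.exp (l * (stripPole q τ v).im) := by
  rw [norm_mul, Complex.norm_exp]
  simp

theorem norm_mul_exp_stripPole_le {Φ : ℂ → ℂ} {δ m ρ : ℝ} (hq : 0 < q) (hρ : 0 < ρ) (hτ : 0 < τ)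
    (hΦ : DiffContOnCl ℂ Φ (Complex.re ⁻¹' Ioo 0 q)) (hm : ∀ v : ℂ, v.re ∈ Icc 0 q → ‖Φ v‖ ≤ m)
    (hδ : ∀ v : ℂ, v.re = 0 → |v.im| ≤ ρ → ‖Φ v‖ ≤ δ) (hδ0 : 0 < δ) (hδm : δ ≤ m)
    (hv : v.re ∈ Icc 0 q) :
    ‖Φ v‖ * Real.exp (τ * Real.log (m / δ) * (stripPole q τ v).im) ≤
      m * Real.exp (τ ^ 2 * Real.log (m / δ) / (1 - Real.exp (-(Real.pi / q * ρ))) ^ 2) := by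
  have hm0 : 0 < m := hδ0.trans_le hδm
  set Λ := Real.log (m / δ)
  have hΛ : 0 ≤ Λ := Real.log_nonneg ((one_le_div hδ0).mpr hδm)
  have hΛm : δ * Real.exp Λ = m := by
    rw [Real.exp_log (by positivity), mul_div_cancel₀ _ hδ0.ne']
  set g : ℂ → ℂ := fun v => Φ v * Complex.exp (-(↑(τ * Λ) * Complex.I) * stripPole q τ v)
  have hg : ∀ v, ‖g v‖ = ‖Φ v‖ * Real.exp (τ * Λ * (stripPole q τ v).im) := fun v =>
    norm_mul_exp_stripPole Φ _
  have hgd : DiffContOnCl ℂ g (Complex.re ⁻¹' Ioo 0 q) :=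
    hΦ.smul (Complex.differentiable_exp.comp_diffContOnCl
      ((diffContOnCl_stripPole hq hτ).const_smul (-(↑(τ * Λ) * Complex.I))))
  have hexp : ∀ v : ℂ, v.re ∈ Icc 0 q → τ * Λ * (stripPole q τ v).im ≤ Λ := fun v hv =>
    calc τ * Λ * (stripPole q τ v).im ≤ τ * Λ * (1 / τ) := by
          gcongr; exact im_stripPole_le hq hτ hv
      _ = Λ := by field_simp
  have hbdd : ∀ v : ℂ, v.re ∈ Icc 0 q → ‖g v‖ ≤ m * Real.exp Λ := fun v hv => by
    rw [hg]
    gcongr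
    exacts [hm v hv, hexp v hv]
  have hoff : ∀ v : ℂ, (v.re = 0 ∧ ρ ≤ |v.im| ∨ v.re = q) →
      ‖g v‖ ≤ m * Real.exp (τ ^ 2 * Λ / (1 - Real.exp (-(Real.pi / q * ρ))) ^ 2) := fun v hv => by
    rw [hg]
    gcongr
    · exact hm v (by rcases hv with h | h <;> simp [h, hq.le])
    · calc τ * Λ * (stripPole q τ v).im
          ≤ τ * Λ * (τ / (1 - Real.exp (-(Real.pi / q * ρ))) ^ 2) := by
            gcongr; exact im_stripPole_le_of_boundary hq hρ hτ hv
        _ = _ := by ring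
  have harc : ∀ v : ℂ, v.re = 0 → |v.im| ≤ ρ → ‖g v‖ ≤ m := fun v hre him => by
    rw [hg, ← hΛm]
    gcongr
    exacts [hδ v hre him, hexp v (by simp [hre, hq.le])]
  rw [← hg]
  refine norm_le_of_forall_re_eq hgd hbdd (fun v hre => ?_) (fun v hre => hoff v (.inr hre)) hv
  rcases le_total ρ |v.im| with him | him
  · exact hoff v (.inl ⟨hre, him⟩)
  · exact (harc v hre him).trans (le_mul_of_one_le_right hm0.le (Real.one_le_exp (by positivity)))

theorem exists_two_constants_strip {q ρ : ℝ} (hq : 0 < q) (hρ : 0 < ρ) (R : ℝ) :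
    ∃ c > 0, ∀ (Φ : ℂ → ℂ) (δ m : ℝ), DiffContOnCl ℂ Φ (Complex.re ⁻¹' Ioo 0 q) →
      (∀ v : ℂ, v.re ∈ Icc 0 q → ‖Φ v‖ ≤ m) →
      (∀ v : ℂ, v.re = 0 → |v.im| ≤ ρ → ‖Φ v‖ ≤ δ) → 0 < δ → δ ≤ m →
        ∀ v : ℂ, v.re = q / 2 → |v.im| ≤ R → ‖Φ v‖ ≤ m * Real.exp (-(c * Real.log (m / δ))) := by
  set κ := Real.exp (-(Real.pi / q * R)) / (1 + (Real.exp (Real.pi / q * R) + 1) ^ 2)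
  set η := 1 - Real.exp (-(Real.pi / q * ρ))
  have : 0 < κ := by positivity
  have hη : 0 < η := sub_pos.mpr (Real.exp_lt_one_iff.mpr (neg_lt_zero.mpr (by positivity)))
  set τ := min 1 (κ * η ^ 2 / 2)
  have hτ : 0 < τ := by positivity
  refine ⟨τ * κ / 2, by positivity, fun Φ δ m hΦ hm hδ hδ0 hδm v hre him => ?_⟩
  have hm0 : 0 < m := hδ0.trans_le hδm
  set Λ := Real.log (m / δ)
  have hΛ : 0 ≤ Λ := Real.log_nonneg ((one_le_div hδ0).mpr hδm)
  have hτη : τ ^ 2 * Λ / η ^ 2 ≤ τ * Λ * (κ / 2) := by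
    rw [div_le_iff₀ (by positivity)]
    have : τ ≤ κ * η ^ 2 / 2 := min_le_right _ _
    calc τ ^ 2 * Λ = τ * Λ * τ := by ring
      _ ≤ τ * Λ * (κ * η ^ 2 / 2) := by gcongr
      _ = _ := by ring
  have hκv : κ ≤ (stripPole q τ v).im := le_im_stripPole hq hτ (min_le_left _ _) hre him
  have hmain := norm_mul_exp_stripPole_le (v := v) hq hρ hτ hΦ hm hδ hδ0 hδm
    ⟨by rw [hre]; positivity, by rw [hre]; linarith⟩
  calc ‖Φ v‖ = ‖Φ v‖ * Real.exp (τ * Λ * κ) * Real.exp (-(τ * Λ * κ)) := by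
        rw [mul_assoc, ← Real.exp_add, add_neg_cancel, Real.exp_zero, mul_one]
    _ ≤ m * Real.exp (τ * Λ * (κ / 2)) * Real.exp (-(τ * Λ * κ)) := by
        gcongr ?_ * _
        calc _ ≤ ‖Φ v‖ * Real.exp (τ * Λ * (stripPole q τ v).im) := by gcongr
          _ ≤ m * Real.exp (τ ^ 2 * Λ / η ^ 2) := hmain
          _ ≤ _ := by gcongr
    _ = m * Real.exp (-(τ * κ / 2 * Λ)) := by
        rw [mul_assoc, ← Real.exp_add]
        congr 2
        ring

end Strip

section Annulus

variable {s : ℝ}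

theorem isOpen_annulus (s : ℝ) : IsOpen (annulus s) :=
  (isOpen_lt continuous_const continuous_norm).inter (isOpen_lt continuous_norm continuous_const)

theorem isBounded_annulus (s : ℝ) : Bornology.IsBounded (annulus s) :=
  isBounded_ball.subset fun _ hz => mem_ball_zero_iff.mpr hz.2

theorem nonempty_annulus (hs0 : 0 < s) (hs1 : s < 1) : (annulus s).Nonempty := by
  obtain ⟨r, hsr, hr1⟩ := exists_between hs1
  exact ⟨r, by simpa [annulus, abs_of_pos (hs0.trans hsr)] using ⟨hsr, hr1⟩⟩

theorem closure_annulus_subset (s : ℝ) : closure (annulus s) ⊆ {z | s ≤ ‖z‖ ∧ ‖z‖ ≤ 1} :=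
  closure_minimal (fun _ hw => And.intro hw.1.le hw.2.le)
    ((isClosed_le continuous_const continuous_norm).inter
      (isClosed_le continuous_norm continuous_const))

theorem frontier_annulus_subset (s : ℝ) : frontier (annulus s) ⊆ bdry s := by
  rintro z ⟨hcl, hint⟩
  have hmem := closure_annulus_subset s hcl
  rw [(isOpen_annulus s).interior_eq] at hint
  rcases hmem.1.eq_or_lt with hs | hs
  · exact .inl (mem_sphere_zero_iff_norm.mpr hs.symm)
  · exact .inr (mem_sphere_zero_iff_norm.mpr
      (hmem.2.eq_or_lt.resolve_right fun h1 => hint ⟨hs, h1⟩))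

theorem neBot_radial (hs0 : 0 < s) (hs1 : s < 1) {ζ : ℂ} (hζ : ζ ∈ bdry s) :
    (𝓝[{r : ℝ | (r : ℂ) * ζ ∈ annulus s}] 1).NeBot := by
  rw [← mem_closure_iff_nhdsWithin_neBot]
  rcases hζ with hζ | hζ <;> rw [mem_sphere_zero_iff_norm] at hζ
  · have h1 : 1 < s⁻¹ := (one_lt_inv₀ hs0).mpr hs1
    refine closure_mono (s := Ioo 1 s⁻¹) (fun r hr => ?_)
      (by rw [closure_Ioo h1.ne]; exact left_mem_Icc.mpr h1.le)
    have hr0 : 0 < r := one_pos.trans hr.1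
    simp only [annulus, mem_ofPred_eq, norm_mul, Complex.norm_real, Real.norm_of_nonneg hr0.le, hζ]
    exact ⟨lt_mul_of_one_lt_left hs0 hr.1, (lt_inv_mul_iff₀' hs0).mp (by simpa using hr.2)⟩
  · refine closure_mono (s := Ioo s 1) (fun r hr => ?_)
      (by rw [closure_Ioo hs1.ne]; exact right_mem_Icc.mpr hs1.le)
    have hr0 : 0 < r := hs0.trans hr.1
    simp only [annulus, mem_ofPred_eq, norm_mul, Complex.norm_real, Real.norm_of_nonneg hr0.le, hζ,
      mul_one]
    exact hr

theorem tendsto_radial (s : ℝ) (ζ : ℂ) :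
    Tendsto (fun r : ℝ => (r : ℂ) * ζ) (𝓝[{r : ℝ | (r : ℂ) * ζ ∈ annulus s}] 1)
      (𝓝[annulus s] ζ) := by
  refine tendsto_nhdsWithin_iff.mpr ⟨?_, eventually_mem_nhdsWithin⟩
  have hcont : Continuous fun r : ℝ => (r : ℂ) * ζ := by fun_prop
  simpa using (hcont.tendsto 1).mono_left nhdsWithin_le_nhds

theorem bdry_subset_closure_annulus (hs0 : 0 < s) (hs1 : s < 1) :
    bdry s ⊆ closure (annulus s) := fun ζ hζ => by
  have := neBot_radial hs0 hs1 hζ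
  exact mem_closure_iff_nhdsWithin_neBot.mpr (this.map _ |>.mono (tendsto_radial s ζ))

theorem bdryValue_eq (hs0 : 0 < s) (hs1 : s < 1) {f : ℂ → ℂ} {ζ a : ℂ} (hζ : ζ ∈ bdry s)
    (h : Tendsto (fun r : ℝ => f (r * ζ)) (𝓝[{r : ℝ | (r : ℂ) * ζ ∈ annulus s}] 1) (𝓝 a)) :
    bdryValue s f ζ = a := by
  have := neBot_radial hs0 hs1 hζ
  exact h.limUnder_eq

theorem bdryValue_eq_of_eqOn (hs0 : 0 < s) (hs1 : s < 1) {f F : ℂ → ℂ} (hF : Continuous F)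
    (hfF : EqOn f F (annulus s)) {ζ : ℂ} (hζ : ζ ∈ bdry s) : bdryValue s f ζ = F ζ := by
  refine bdryValue_eq hs0 hs1 hζ (Tendsto.congr' ?_ (((hF.tendsto ζ).mono_left
    nhdsWithin_le_nhds).comp (tendsto_radial s ζ)))
  filter_upwards [self_mem_nhdsWithin] with r hr using (hfF hr).symm

theorem norm_le_of_norm_le_bdry {F : ℂ → ℂ} {C : ℝ} (hF : DiffContOnCl ℂ F (annulus s))
    (hC : ∀ ζ ∈ bdry s, ‖F ζ‖ ≤ C) {z : ℂ} (hz : z ∈ closure (annulus s)) : ‖F z‖ ≤ C :=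
  Complex.norm_le_of_forall_mem_frontier_norm_le (isBounded_annulus s) hF
    (fun ζ hζ => hC ζ (frontier_annulus_subset s hζ)) hz

theorem norm_log_le {u : ℂ} {L : ℝ} (hL : 1 ≤ L) (hu : |Real.log ‖u‖| ≤ L) :
    ‖Complex.log u‖ ≤ 2 * (L + Real.pi) * ‖u - 1‖ := by
  rcases le_total ‖u - 1‖ (1 / 2) with h | h
  · have hlog := Complex.norm_log_one_add_half_le_self h
    rw [add_sub_cancel] at hlog
    exact hlog.trans (by gcongr; linarith [Real.pi_pos])
  · calc ‖Complex.log u‖ ≤ |Real.log ‖u‖| + |u.arg| := by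
          simpa only [Complex.log_re, Complex.log_im] using
            Complex.norm_le_abs_re_add_abs_im (Complex.log u)
      _ ≤ L + Real.pi := add_le_add hu (Complex.abs_arg_le_pi u)
      _ = 2 * (L + Real.pi) * (1 / 2) := by ring
      _ ≤ _ := by gcongr

theorem exp_mem_annulus_iff (hs0 : 0 < s) {v : ℂ} :
    Complex.exp v ∈ annulus s ↔ v.re ∈ Ioo (Real.log s) 0 := by
  simp [annulus, Complex.norm_exp, ← Real.log_lt_iff_lt_exp hs0]

theorem norm_comp_exp_sub_le (hs0 : 0 < s) {f : ℂ → ℂ} {M : ℝ}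
    (hf : DifferentiableOn ℂ f (annulus s)) (hM : ∀ z ∈ annulus s, ‖deriv f z‖ ≤ M) {a b : ℂ}
    (ha : a.re ∈ Ioo (Real.log s) 0) (hb : b.re ∈ Ioo (Real.log s) 0) :
    ‖f (Complex.exp b) - f (Complex.exp a)‖ ≤ M * ‖b - a‖ := by
  have hconv : Convex ℝ (Complex.re ⁻¹' Ioo (Real.log s) 0) :=
    (convex_Ioo _ _).linear_preimage Complex.reLm
  refine hconv.norm_image_sub_le_of_norm_hasDerivWithin_le (𝕜 := ℂ)
    (f := fun v => f (Complex.exp v)) (f' := fun v => deriv f (Complex.exp v) * Complex.exp v)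
    (fun v hv => ?_) (fun v hv => ?_) ha hb
  · have hmem := (exp_mem_annulus_iff hs0).mpr hv
    exact (((hf.differentiableAt ((isOpen_annulus s).mem_nhds hmem)).hasDerivAt.comp v
      (Complex.hasDerivAt_exp v))).hasDerivWithinAt
  · have hmem := (exp_mem_annulus_iff hs0).mpr hv
    rw [norm_mul]
    exact (mul_le_of_le_one_right (norm_nonneg _) hmem.2.le).trans (hM _ hmem)

theorem exists_lipschitzOnWith (hs0 : 0 < s) (M : ℝ) : ∃ C : NNReal, ∀ f : ℂ → ℂ,
    DifferentiableOn ℂ f (annulus s) → (∀ z ∈ annulus s, ‖deriv f z‖ ≤ M) →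
      LipschitzOnWith C f (annulus s) := by
  set L := 1 + |Real.log s|
  refine ⟨(|M| * (2 * (L + Real.pi) * s⁻¹)).toNNReal, fun f hf hM =>
    LipschitzOnWith.of_dist_le_mul fun w hw z hz => ?_⟩
  have hz0 : z ≠ 0 := norm_pos_iff.mp (hs0.trans hz.1)
  have hw0 : w ≠ 0 := norm_pos_iff.mp (hs0.trans hw.1)
  have hz' : (Complex.log z).re ∈ Ioo (Real.log s) 0 :=
    (exp_mem_annulus_iff hs0).mp (by rwa [Complex.exp_log hz0])
  have hexp : Complex.exp (Complex.log z + Complex.log (w / z)) = w := by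
    rw [Complex.exp_add, Complex.exp_log hz0, Complex.exp_log (div_ne_zero hw0 hz0),
      mul_div_cancel₀ _ hz0]
  have hw' := (exp_mem_annulus_iff hs0).mp (hexp.symm ▸ hw)
  have hlog : |Real.log ‖w / z‖| ≤ L := by
    rw [Complex.add_re, Complex.log_re (w / z)] at hw'
    rw [abs_le]
    constructor <;> linarith [hz'.1, hz'.2, hw'.1, hw'.2, neg_abs_le (Real.log s)]
  have hsub := norm_comp_exp_sub_le hs0 hf hM hz' hw'
  rw [hexp, Complex.exp_log hz0, add_sub_cancel_left] at hsub
  rw [dist_eq_norm, dist_eq_norm, Real.coe_toNNReal _ (by positivity)]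
  calc ‖f w - f z‖ ≤ |M| * ‖Complex.log (w / z)‖ := hsub.trans (by gcongr; exact le_abs_self M)
    _ ≤ |M| * (2 * (L + Real.pi) * ‖w / z - 1‖) := by
        gcongr
        exact norm_log_le (le_add_of_nonneg_right (abs_nonneg _)) hlog
    _ ≤ |M| * (2 * (L + Real.pi) * (s⁻¹ * ‖w - z‖)) := by
        rw [div_sub_one hz0, norm_div, div_eq_inv_mul]
        gcongr
        exact hz.1.le
    _ = _ := by ring

theorem exists_lipschitzWith_eqOn (hs0 : 0 < s) (M : ℝ) : ∃ C : NNReal, ∀ f : ℂ → ℂ,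
    DifferentiableOn ℂ f (annulus s) → (∀ z ∈ annulus s, ‖deriv f z‖ ≤ M) →
      ∃ F : ℂ → ℂ, LipschitzWith C F ∧ EqOn f F (annulus s) := by
  obtain ⟨C, hC⟩ := exists_lipschitzOnWith hs0 M
  exact ⟨_, fun f hf hM => (hC f hf hM).extend_finite_dimension⟩

end Annulus

section Fatou

variable {s : ℝ}

theorem norm_pos_of_mem_bdry (hs0 : 0 < s) {p : ℂ} (hp : p ∈ bdry s) : 0 < ‖p‖ := by
  rcases hp with hp | hp <;> rw [mem_sphere_zero_iff_norm] at hp <;> rw [hp]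
  exacts [hs0, one_pos]

theorem notMem_bdry_of_mem_annulus {z : ℂ} (hz : z ∈ annulus s) : z ∉ bdry s := by
  rintro (h | h) <;> rw [mem_sphere_zero_iff_norm] at h
  exacts [hz.1.ne' h, hz.2.ne h]

theorem sq_norm_sub_one_add_smul (x : ℝ) (p z : ℂ) :
    ‖z - (1 + x) * p‖ ^ 2 =
      (1 + x) * ‖z - p‖ ^ 2 + (x * ‖p‖) ^ 2 + x * (‖p‖ ^ 2 - ‖z‖ ^ 2) := by
  rw [mul_pow]
  simp only [Complex.sq_norm, Complex.normSq_apply, Complex.add_re, Complex.add_im, Complex.sub_re,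
    Complex.sub_im, Complex.mul_re, Complex.mul_im, Complex.ofReal_re, Complex.ofReal_im,
    Complex.one_re, Complex.one_im]
  ring

theorem half_sq_add_sq_le (hs0 : 0 < s) {x : ℝ} {p z : ℂ} (hp : p ∈ bdry s) (hx : |x| ≤ 1 / 2)
    (hxp : ((1 - x : ℝ) : ℂ) * p ∈ annulus s) (hz : z ∈ closure (annulus s)) :
    ‖z - p‖ ^ 2 / 2 + (|x| * ‖p‖) ^ 2 ≤ ‖z - (1 + x) * p‖ ^ 2 := by
  obtain ⟨hx₁, hx₂⟩ := abs_le.mp hx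
  obtain ⟨hz₁, hz₂⟩ := closure_annulus_subset s hz
  -- The sign of `x` says on which of the two circles `p` lies.
  have hsign : 0 ≤ x * (‖p‖ ^ 2 - ‖z‖ ^ 2) := by
    obtain ⟨h₁, h₂⟩ := hxp
    rw [norm_mul, Complex.norm_real, Real.norm_of_nonneg (by linarith)] at h₁ h₂
    rcases hp with hp | hp <;> rw [mem_sphere_zero_iff_norm] at hp <;> rw [hp] at h₁ h₂ ⊢
    · exact mul_nonneg_of_nonpos_of_nonpos (by nlinarith) (by nlinarith)
    · exact mul_nonneg (by linarith) (by nlinarith)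
  rw [sq_norm_sub_one_add_smul, mul_pow, mul_pow, sq_abs]
  nlinarith [sq_nonneg ‖z - p‖]

theorem closedBall_subset_annulus (hs0 : 0 < s) {x : ℝ} {p : ℂ} (hp : p ∈ bdry s)
    (hx : |x| < (1 - s) / 2) (hxp : ((1 - x : ℝ) : ℂ) * p ∈ annulus s) :
    closedBall (((1 - x : ℝ) : ℂ) * p) (|x| * ‖p‖ / 2) ⊆ annulus s := by
  intro z hz
  rw [mem_closedBall_iff_norm] at hz
  obtain ⟨hx₁, hx₂⟩ := abs_lt.mp hx
  have hz₁ := norm_sub_norm_le (((1 - x : ℝ) : ℂ) * p) z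
  have hz₂ := norm_sub_norm_le z (((1 - x : ℝ) : ℂ) * p)
  rw [norm_sub_rev] at hz₁
  obtain ⟨h₁, h₂⟩ := hxp
  rw [norm_mul, Complex.norm_real, Real.norm_of_nonneg (by linarith)] at h₁ h₂ hz₁ hz₂
  rcases hp with hp | hp <;> rw [mem_sphere_zero_iff_norm] at hp <;>
    rw [hp] at h₁ h₂ hz₁ hz₂ hz
  · have hx0 : x < 0 := by nlinarith
    rw [abs_of_neg hx0] at hz
    constructor <;> nlinarith
  · have hx0 : 0 < x := by linarith
    rw [abs_of_pos hx0] at hz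
    constructor <;> linarith

/-- Maximum principle for `Ψ z * t / (z - b) ^ 2`, where `t = |x| ‖p‖` and `b = (1 + x) p` is the
reflection of `(1 - x) p` in `p`. -/
theorem norm_mul_le_of_norm_le_bdry (hs0 : 0 < s) (hs1 : s < 1) {Ψ : ℂ → ℂ} {M ε ρ x : ℝ} {p : ℂ}
    (hε : 0 ≤ ε) (hp : p ∈ bdry s) (hΨ : DiffContOnCl ℂ Ψ (annulus s))
    (hM : ∀ z ∈ bdry s, ‖Ψ z‖ ≤ M * ‖z - p‖)
    (hρ : ∀ z ∈ bdry s, ‖z - p‖ < ρ → ‖Ψ z‖ ≤ ε * ‖z - p‖) (hx0 : x ≠ 0) (hx : |x| ≤ 1 / 2)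
    (hxp : ((1 - x : ℝ) : ℂ) * p ∈ annulus s) (hMρ : M * (|x| * ‖p‖) ≤ ε * ρ) {z : ℂ}
    (hz : z ∈ annulus s) :
    ‖Ψ z‖ * (|x| * ‖p‖) ≤ 2 * ε * ‖z - (1 + x) * p‖ ^ 2 := by
  set t := |x| * ‖p‖
  have hp0 := norm_pos_of_mem_bdry hs0 hp
  have ht : 0 < t := by positivity
  have hpole : ∀ w ∈ closure (annulus s), ‖w - p‖ ^ 2 / 2 + t ^ 2 ≤ ‖w - (1 + x) * p‖ ^ 2 :=
    fun w hw => half_sq_add_sq_le hs0 hp hx hxp hw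
  have hne : ∀ w ∈ closure (annulus s), (w - (1 + x) * p) ^ 2 ≠ 0 := fun w hw h0 => by
    have := hpole w hw
    rw [pow_eq_zero_iff two_ne_zero] at h0
    rw [h0, norm_zero] at this
    nlinarith [sq_nonneg ‖w - p‖]
  set g : ℂ → ℂ := fun w => ((w - (1 + x) * p) ^ 2)⁻¹ * (Ψ w * t)
  have hg : ∀ w ∈ closure (annulus s), ‖g w‖ * ‖w - (1 + x) * p‖ ^ 2 = ‖Ψ w‖ * t := fun w hw => by
    rw [← norm_pow, ← norm_mul, mul_right_comm, inv_mul_cancel₀ (hne w hw), one_mul, norm_mul,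
      Complex.norm_real, Real.norm_of_nonneg ht.le]
  have hgd : DiffContOnCl ℂ g (annulus s) :=
    (DiffContOnCl.inv (Differentiable.diffContOnCl (by fun_prop)) hne).smul (hΨ.smul_const (t : ℂ))
  have hbd : ∀ w ∈ bdry s, ‖g w‖ ≤ 2 * ε := fun w hw => by
    have hw' := bdry_subset_closure_annulus hs0 hs1 hw
    have hpos : 0 < ‖w - (1 + x) * p‖ ^ 2 := norm_pow (w - (1 + x) * p) 2 ▸
      norm_pos_iff.mpr (hne w hw')
    have hpole_w := hpole w hw'
    refine le_of_mul_le_mul_right ?_ hpos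
    rw [hg w hw']
    rcases lt_or_ge ‖w - p‖ ρ with hwρ | hwρ
    · calc ‖Ψ w‖ * t ≤ ε * ‖w - p‖ * t := by gcongr; exact hρ w hw hwρ
        _ ≤ ε * (‖w - p‖ ^ 2 / 2 + t ^ 2) := by nlinarith [sq_nonneg (‖w - p‖ - t), sq_nonneg t]
        _ ≤ 2 * ε * ‖w - (1 + x) * p‖ ^ 2 := by nlinarith
    · calc ‖Ψ w‖ * t ≤ M * ‖w - p‖ * t := by gcongr; exact hM w hw
        _ = M * t * ‖w - p‖ := by ring
        _ ≤ ε * ‖w - p‖ * ‖w - p‖ := by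
            gcongr ?_ * _
            exact hMρ.trans (by gcongr)
        _ ≤ 2 * ε * ‖w - (1 + x) * p‖ ^ 2 := by nlinarith [sq_nonneg t]
  have := norm_le_of_norm_le_bdry hgd hbd (subset_closure hz)
  rw [← hg z (subset_closure hz)]
  gcongr

theorem norm_deriv_le_of_norm_le_bdry (hs0 : 0 < s) (hs1 : s < 1) {Ψ : ℂ → ℂ} {M ε ρ x : ℝ}
    {p : ℂ} (hε : 0 ≤ ε) (hp : p ∈ bdry s) (hΨ : DiffContOnCl ℂ Ψ (annulus s))
    (hM : ∀ z ∈ bdry s, ‖Ψ z‖ ≤ M * ‖z - p‖)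
    (hρ : ∀ z ∈ bdry s, ‖z - p‖ < ρ → ‖Ψ z‖ ≤ ε * ‖z - p‖) (hx : |x| < (1 - s) / 2)
    (hxp : ((1 - x : ℝ) : ℂ) * p ∈ annulus s) (hMρ : M * (|x| * ‖p‖) ≤ ε * ρ) :
    ‖deriv Ψ ((1 - x : ℝ) * p)‖ ≤ 25 * ε := by
  have hx0 : x ≠ 0 := by
    rintro rfl
    rw [sub_zero, Complex.ofReal_one, one_mul] at hxp
    exact notMem_bdry_of_mem_annulus hxp hp
  have hp0 := norm_pos_of_mem_bdry hs0 hp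
  set c : ℂ := (1 - x : ℝ) * p
  set t := |x| * ‖p‖
  have ht : 0 < t := by positivity
  have hball : closedBall c (t / 2) ⊆ annulus s := closedBall_subset_annulus hs0 hp hx hxp
  have hcb : ‖c - (1 + x) * p‖ = 2 * t := by
    rw [show c - (1 + x) * p = ((-(2 * x) : ℝ) : ℂ) * p by push_cast [c]; ring, norm_mul,
      Complex.norm_real, norm_neg, norm_mul, Real.norm_two, Real.norm_eq_abs, mul_assoc]
  have hsphere : ∀ z ∈ sphere c (t / 2), ‖Ψ z‖ ≤ 25 * ε * (t / 2) := fun z hz => by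
    have hzb : ‖z - (1 + x) * p‖ ≤ 5 / 2 * t := by
      have htri := norm_sub_le_norm_sub_add_norm_sub z c ((1 + x) * p)
      rw [hcb, mem_sphere_iff_norm.mp hz] at htri
      linarith
    refine le_of_mul_le_mul_right ?_ ht
    calc ‖Ψ z‖ * t ≤ 2 * ε * ‖z - (1 + x) * p‖ ^ 2 :=
          norm_mul_le_of_norm_le_bdry hs0 hs1 hε hp hΨ hM hρ hx0 (by linarith) hxp hMρ
            (hball (sphere_subset_closedBall hz))
      _ ≤ 2 * ε * (5 / 2 * t) ^ 2 := by gcongr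
      _ = 25 * ε * (t / 2) * t := by ring
  calc ‖deriv Ψ c‖ ≤ 25 * ε * (t / 2) / (t / 2) :=
        Complex.norm_deriv_le_of_forall_mem_sphere_norm_le (by positivity)
          ((hΨ.differentiableOn.mono hball).diffContOnCl_ball subset_rfl) hsphere
    _ = 25 * ε := mul_div_cancel_right₀ _ (by positivity)

theorem tendsto_deriv_radial (hs0 : 0 < s) (hs1 : s < 1) {F : ℂ → ℂ} {C : NNReal}
    (hF : LipschitzWith C F) (hd : DifferentiableOn ℂ F (annulus s)) {p a : ℂ} (hp : p ∈ bdry s)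
    (h : HasDerivWithinAt F a (bdry s) p) :
    Tendsto (fun r : ℝ => deriv F (r * p)) (𝓝[{r : ℝ | (r : ℂ) * p ∈ annulus s}] 1) (𝓝 a) := by
  set Ψ : ℂ → ℂ := fun z => F z - F p - (z - p) • a
  have hM : ∀ z ∈ bdry s, ‖Ψ z‖ ≤ (C + ‖a‖) * ‖z - p‖ := fun z _ => by
    rw [add_mul]
    refine (norm_sub_le _ _).trans (add_le_add (hF.norm_sub_le z p) ?_)
    rw [norm_smul, mul_comm]
  have hΨ : DiffContOnCl ℂ Ψ (annulus s) :=
    ⟨by fun_prop, by have := hF.continuous; fun_prop⟩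
  have hderiv : ∀ z ∈ annulus s, deriv Ψ z = deriv F z - a := fun z hz => by
    have hFz := (hd.differentiableAt ((isOpen_annulus s).mem_nhds hz)).hasDerivAt
    exact (((hFz.sub_const (F p)).sub (((hasDerivAt_id z).sub_const p).smul_const a)).deriv).trans
      (by rw [one_smul])
  refine Metric.tendsto_nhds.mpr fun ε' hε' => ?_
  set ε := ε' / 50
  have hε : 0 < ε := by positivity
  obtain ⟨ρ, hρ0, hρ⟩ : ∃ ρ > 0, ∀ z ∈ bdry s, ‖z - p‖ < ρ → ‖Ψ z‖ ≤ ε * ‖z - p‖ := by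
    obtain ⟨ρ, hρ0, hρ⟩ := Metric.mem_nhdsWithin_iff.mp
      ((hasDerivWithinAt_iff_isLittleO.mp h).def hε)
    exact ⟨ρ, hρ0, fun z hz hzp => hρ ⟨mem_ball_iff_norm.mpr hzp, hz⟩⟩
  have hsmall : ∀ᶠ r : ℝ in 𝓝 1, (C + ‖a‖) * (|1 - r| * ‖p‖) < ε * ρ ∧ |1 - r| < (1 - s) / 2 := by
    have hcont : Continuous fun r : ℝ => (C + ‖a‖) * (|1 - r| * ‖p‖) := by fun_prop
    have hcont' : Continuous fun r : ℝ => |1 - r| := by fun_prop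
    exact ((hcont.tendsto 1).eventually_lt_const (by simpa using by positivity)).and
      ((hcont'.tendsto 1).eventually_lt_const (by simpa using hs1))
  filter_upwards [nhdsWithin_le_nhds hsmall, self_mem_nhdsWithin] with r hr hrp
  rw [← sub_sub_cancel 1 r] at hrp ⊢
  rw [dist_eq_norm, ← hderiv _ hrp]
  calc _ ≤ 25 * ε := norm_deriv_le_of_norm_le_bdry hs0 hs1 hε.le hp hΨ hM hρ hr.2 hrp hr.1.le
    _ < ε' := by simp only [ε]; linarith

end Fatou

section BoundaryValues

variable {s r : ℝ}

theorem norm_sub_le_of_ae_norm_deriv_le {E : Type*} [NormedAddCommGroup E] [NormedSpace ℝ E]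
    [FiniteDimensional ℝ E] {γ : ℝ → E} {C : NNReal} (hγ : LipschitzWith C γ) {K : ℝ}
    (hK : ∀ᵐ θ : ℝ, ‖deriv γ θ‖ ≤ K) (x y : ℝ) : ‖γ x - γ y‖ ≤ K * |x - y| := by
  obtain ⟨ℓ, hℓ, hℓγ⟩ := exists_dual_vector'' ℝ (γ x - γ y)
  have hac : AbsolutelyContinuousOnInterval (ℓ ∘ γ) y x :=
    (ℓ.lipschitz.comp hγ).lipschitzOnWith.absolutelyContinuousOnInterval
  have hbound : ‖∫ t in y..x, deriv (ℓ ∘ γ) t‖ ≤ K * |x - y| := by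
    refine intervalIntegral.norm_integral_le_of_norm_le_const_ae ?_
    filter_upwards [hK, hγ.ae_differentiableAt_real] with t ht htd _
    rw [(ℓ.hasFDerivAt.comp_hasDerivAt t htd.hasDerivAt).deriv]
    exact (ℓ.le_of_opNorm_le hℓ _).trans (by rwa [one_mul])
  rw [hac.integral_deriv_eq_sub, Function.comp_apply, Function.comp_apply, ← map_sub, hℓγ] at hbound
  simpa using hbound

/-- The angle in `(θ₀ - π, θ₀ + π]` of a point `z` of the circle of radius `r` about `0`; it inverts
`circleMap 0 r` and is continuous away from the point opposite to the one of angle `θ₀`. -/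
noncomputable def circleAngle (r θ₀ : ℝ) (z : ℂ) : ℝ := θ₀ + (z / circleMap 0 r θ₀).arg

theorem norm_div_circleMap (hr : 0 < r) (θ₀ : ℝ) {z : ℂ} (hz : z ∈ sphere (0 : ℂ) r) :
    ‖z / circleMap 0 r θ₀‖ = 1 := by
  rw [norm_div, mem_sphere_zero_iff_norm.mp hz, norm_circleMap_zero, abs_of_pos hr,
    div_self hr.ne']

theorem circleMap_circleAngle (hr : 0 < r) (θ₀ : ℝ) {z : ℂ} (hz : z ∈ sphere (0 : ℂ) r) :
    circleMap 0 r (circleAngle r θ₀ z) = z := by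
  have hp : circleMap 0 r θ₀ ≠ 0 := circleMap_ne_center hr.ne'
  have hexp := Complex.norm_mul_exp_arg_mul_I (z / circleMap 0 r θ₀)
  rw [norm_div_circleMap hr θ₀ hz, Complex.ofReal_one, one_mul] at hexp
  rw [circleAngle, circleMap_zero, Complex.ofReal_add, add_mul, Complex.exp_add, hexp, ← mul_assoc,
    ← circleMap_zero, mul_div_cancel₀ _ hp]

theorem circleAngle_sub_eq (hr : 0 < r) (θ₀ : ℝ) {z : ℂ} (hz : z ∈ sphere (0 : ℂ) r) :
    ((circleAngle r θ₀ z - θ₀ : ℝ) : ℂ) = -Complex.I * Complex.log (z / circleMap 0 r θ₀) := by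
  rw [circleAngle, add_sub_cancel_left, Complex.log, norm_div_circleMap hr θ₀ hz, Real.log_one,
    Complex.ofReal_zero, zero_add, mul_left_comm, neg_mul, Complex.I_mul_I, neg_neg, mul_one]

theorem continuousAt_circleAngle {θ₀ : ℝ} {z : ℂ}
    (hz : z / circleMap 0 r θ₀ ∈ Complex.slitPlane) : ContinuousAt (circleAngle r θ₀) z :=
  continuousAt_const.add
    (ContinuousAt.comp (f := fun z => z / circleMap 0 r θ₀) (Complex.continuousAt_arg hz)
      (continuousAt_id.div_const _))

theorem sphere_subset_bdry (hr : r = s ∨ r = 1) : sphere (0 : ℂ) r ⊆ bdry s := by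
  rcases hr with rfl | rfl
  exacts [subset_union_left, subset_union_right]

theorem sphere_mem_nhdsWithin_bdry (hs1 : s ≠ 1) (hr : r = s ∨ r = 1) {p : ℂ}
    (hp : p ∈ sphere (0 : ℂ) r) : sphere (0 : ℂ) r ∈ 𝓝[bdry s] p := by
  rw [mem_sphere_zero_iff_norm] at hp
  rcases hr with rfl | rfl
  · filter_upwards [self_mem_nhdsWithin, nhdsWithin_le_nhds (isClosed_sphere.isOpen_compl.mem_nhds
      (show p ∈ (sphere 0 1)ᶜ by simp [hp, hs1]))] with z hz hz' using hz.resolve_right hz'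
  · filter_upwards [self_mem_nhdsWithin, nhdsWithin_le_nhds (isClosed_sphere.isOpen_compl.mem_nhds
      (show p ∈ (sphere 0 s)ᶜ by simp [hp, hs1.symm]))] with z hz hz' using hz.resolve_left hz'

theorem hasDerivWithinAt_sphere_of_comp_circleMap (hr : 0 < r) {F : ℂ → ℂ} {b : ℂ} {θ : ℝ}
    (h : HasDerivAt (fun θ => F (circleMap 0 r θ)) b θ) :
    HasDerivWithinAt F (b / (circleMap 0 r θ * Complex.I)) (sphere 0 r) (circleMap 0 r θ) := by
  set p := circleMap 0 r θ with hp
  have hp0 : p ≠ 0 := circleMap_ne_center hr.ne'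
  have hlog : HasDerivAt (fun z => Complex.log (z / p)) (1 / p) p := by
    simpa [hp0] using ((hasDerivAt_id p).div_const p).clog
      (by rw [id, div_self hp0]; exact Complex.one_mem_slitPlane)
  have hangle : Tendsto (circleAngle r θ) (𝓝 p) (𝓝 θ) := by
    have hcont : ContinuousAt (circleAngle r θ) p :=
      continuousAt_circleAngle (by rw [div_self hp0]; exact Complex.one_mem_slitPlane)
    simpa [ContinuousAt, circleAngle, ← hp, hp0] using hcont
  have hdslope : Tendsto (fun z => dslope (fun θ => F (circleMap 0 r θ)) θ (circleAngle r θ z))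
      (𝓝 p) (𝓝 b) := by
    have hcont := continuousAt_dslope_same.mpr h.differentiableAt
    rw [ContinuousAt, dslope_same, h.deriv] at hcont
    exact hcont.comp hangle
  rw [hasDerivWithinAt_iff_tendsto_slope]
  have hprod := (hdslope.mono_left nhdsWithin_le_nhds).mul
    ((hasDerivWithinAt_iff_tendsto_slope.mp
      (hlog.hasDerivWithinAt (s := sphere 0 r))).const_mul (-Complex.I))
  rw [show b * (-Complex.I * (1 / p)) = b / (p * Complex.I) by
    field_simp; rw [Complex.I_sq]; ring] at hprod
  refine hprod.congr' ?_
  filter_upwards [self_mem_nhdsWithin] with z hz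
  have hsub := sub_smul_dslope (fun θ => F (circleMap 0 r θ)) θ (circleAngle r θ z)
  rw [circleMap_circleAngle hr θ hz.1, Complex.real_smul, circleAngle_sub_eq hr θ hz.1] at hsub
  rw [slope_def_module, slope_def_module, smul_eq_mul, smul_eq_mul, div_self hp0, Complex.log_one,
    sub_zero, ← hsub]
  ring

theorem norm_comp_circleMap_sub_le (hs0 : 0 < s) (hs1 : s < 1) (hr : r = s ∨ r = 1) {F : ℂ → ℂ}
    {C : NNReal} (hF : LipschitzWith C F) (hd : DifferentiableOn ℂ F (annulus s)) {K : ℝ}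
    (hK : ∀ᵐ θ : ℝ, ‖bdryValue s (deriv F) (circleMap 0 r θ)‖ ≤ K) (x y : ℝ) :
    ‖F (circleMap 0 r x) - F (circleMap 0 r y)‖ ≤ K * |x - y| := by
  have hr0 : 0 < r := by rcases hr with rfl | rfl; exacts [hs0, one_pos]
  have hr1 : r ≤ 1 := by rcases hr with rfl | rfl; exacts [hs1.le, le_rfl]
  have hγ := hF.comp (lipschitzWith_circleMap 0 r)
  refine norm_sub_le_of_ae_norm_deriv_le hγ ?_ x y
  filter_upwards [hK, hγ.ae_differentiableAt_real] with θ hθ hdiff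
  set p := circleMap 0 r θ
  have hp : p ∈ sphere (0 : ℂ) r := circleMap_mem_sphere 0 hr0.le θ
  have hderiv : HasDerivWithinAt F (deriv (F ∘ circleMap 0 r) θ / (p * Complex.I)) (bdry s) p :=
    (hasDerivWithinAt_sphere_of_comp_circleMap hr0 hdiff.hasDerivAt).mono_of_mem_nhdsWithin
      (sphere_mem_nhdsWithin_bdry hs1.ne hr hp)
  have hpb := sphere_subset_bdry hr hp
  rw [bdryValue_eq hs0 hs1 hpb (tendsto_deriv_radial hs0 hs1 hF hd hpb hderiv), norm_div, norm_mul,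
    Complex.norm_I, mul_one, mem_sphere_zero_iff_norm.mp hp, div_le_iff₀ hr0] at hθ
  exact hθ.trans (mul_le_of_le_one_right
    (nonneg_of_mul_nonneg_left ((norm_nonneg _).trans hθ) hr0) hr1)

theorem exp_mul_mem_annulus (t : ℝ) {z : ℂ} :
    Complex.exp (t * Complex.I) * z ∈ annulus s ↔ z ∈ annulus s := by
  simp [annulus, Complex.norm_exp_ofReal_mul_I]

theorem norm_exp_mul_sub_le (hs0 : 0 < s) (hs1 : s < 1) {F : ℂ → ℂ}
    {C : NNReal} (hF : LipschitzWith C F) (hd : DifferentiableOn ℂ F (annulus s)) {K : ℝ}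
    (hK : ∀ r, r = s ∨ r = 1 → ∀ᵐ θ : ℝ, ‖bdryValue s (deriv F) (circleMap 0 r θ)‖ ≤ K) (t : ℝ)
    {z : ℂ} (hz : z ∈ annulus s) : ‖F (Complex.exp (t * Complex.I) * z) - F z‖ ≤ K * |t| := by
  set G : ℂ → ℂ := fun z => F (Complex.exp (t * Complex.I) * z) - F z
  have hG : DiffContOnCl ℂ G (annulus s) :=
    ⟨(hd.comp (by fun_prop) fun w hw => (exp_mul_mem_annulus t).mpr hw).sub hd,
      ((hF.continuous.comp (by fun_prop)).sub hF.continuous).continuousOn⟩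
  refine norm_le_of_norm_le_bdry hG (fun ζ hζ => ?_) (subset_closure hz)
  obtain ⟨r, hr, hζr⟩ : ∃ r, (r = s ∨ r = 1) ∧ ‖ζ‖ = r := by simpa [bdry] using hζ
  have hrot : Complex.exp (t * Complex.I) * ζ = circleMap 0 r (ζ.arg + t) := by
    conv_lhs => rw [← Complex.norm_mul_exp_arg_mul_I ζ]
    rw [circleMap_zero, hζr, Complex.ofReal_add, add_mul, Complex.exp_add]
    ring
  have hcirc : ζ = circleMap 0 r ζ.arg := by
    rw [circleMap_zero, ← hζr, Complex.norm_mul_exp_arg_mul_I]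
  have hsub := norm_comp_circleMap_sub_le hs0 hs1 hr hF hd (hK r hr) (ζ.arg + t) ζ.arg
  rwa [← hrot, ← hcirc, add_sub_cancel_left] at hsub

theorem norm_deriv_le_of_ae_norm_bdryValue_le (hs0 : 0 < s) (hs1 : s < 1) {F : ℂ → ℂ}
    {C : NNReal} (hF : LipschitzWith C F) (hd : DifferentiableOn ℂ F (annulus s)) {K : ℝ}
    (hK : ∀ r, r = s ∨ r = 1 → ∀ᵐ θ : ℝ, ‖bdryValue s (deriv F) (circleMap 0 r θ)‖ ≤ K)
    {z : ℂ} (hz : z ∈ annulus s) : ‖deriv F z‖ ≤ K / s := by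
  have hK0 : 0 ≤ K := by
    obtain ⟨θ, hθ⟩ := (hK s (.inl rfl)).exists
    exact (norm_nonneg _).trans hθ
  have hrot : HasDerivAt (fun t : ℝ => Complex.exp (t * Complex.I) * z) (Complex.I * z) 0 := by
    simpa using (((hasDerivAt_id (0 : ℝ)).ofReal_comp.mul_const Complex.I).cexp.mul_const z)
  have hFz : HasDerivAt F (deriv F z) (Complex.exp ((0 : ℝ) * Complex.I) * z) := by
    simpa using (hd.differentiableAt ((isOpen_annulus s).mem_nhds hz)).hasDerivAt
  have hle : ‖deriv F z * (Complex.I * z)‖ ≤ K :=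
    (hFz.comp (0 : ℝ) hrot).le_of_lip' hK0 <| .of_forall fun t => by
      simpa using norm_exp_mul_sub_le hs0 hs1 hF hd hK t hz
  rw [norm_mul, norm_mul, Complex.norm_I, one_mul] at hle
  rw [le_div_iff₀ hs0]
  exact le_trans (by gcongr; exact hz.1.le) hle

end BoundaryValues

section SobolevBounds

variable {s r : ℝ}

theorem circleMeasure_le_bdryMeasure (hr : r = s ∨ r = 1) : circleMeasure r ≤ bdryMeasure s := by
  rcases hr with rfl | rfl
  exacts [Measure.le_add_right le_rfl, Measure.le_add_left le_rfl]

theorem ae_circleMap_of_ae_circleMeasure {P : ℂ → Prop} (h : ∀ᵐ ζ ∂circleMeasure r, P ζ) :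
    ∀ᵐ θ : ℝ, P (circleMap 0 r θ) := by
  have hperiod : ∀ᵐ θ : ℝ, θ ∈ Ioc 0 (2 * Real.pi) → P (circleMap 0 r θ) := by
    have hmap := ae_of_ae_map (measurable_circleMap 0 r).aemeasurable h
    rwa [Measure.ae_ennreal_smul_measure_iff (by positivity), ae_restrict_iff' measurableSet_Ioc]
      at hmap
  have htranslate : ∀ n : ℤ, ∀ᵐ θ : ℝ, θ + n * (2 * Real.pi) ∈ Ioc 0 (2 * Real.pi) →
      P (circleMap 0 r (θ + n * (2 * Real.pi))) := fun n =>
    (measurePreserving_add_right volume (n * (2 * Real.pi))).quasiMeasurePreserving.ae hperiod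
  filter_upwards [ae_all_iff.mpr htranslate] with θ hθ
  obtain ⟨n, hn, -⟩ := existsUnique_add_zsmul_mem_Ioc Real.two_pi_pos θ 0
  rw [zero_add, zsmul_eq_mul] at hn
  rw [← (periodic_circleMap 0 r).int_mul n θ]
  exact hθ n hn

theorem ae_norm_bdryValue_le (hr0 : 0 ≤ r) (hr : r = s ∨ r = 1) {g : ℂ → ℂ} {K : ℝ}
    (hK : 0 ≤ K) (h : supNorm s (bdry s ∩ sphere 0 r) g ≤ ENNReal.ofReal K) :
    ∀ᵐ θ : ℝ, ‖bdryValue s g (circleMap 0 r θ)‖ ≤ K := by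
  rw [inter_eq_right.mpr (sphere_subset_bdry hr), supNorm, eLpNorm_exponent_top] at h
  have hsphere : ∀ᵐ ζ ∂(bdryMeasure s).restrict (sphere 0 r), ‖bdryValue s g ζ‖ ≤ K := by
    filter_upwards [ae_le_eLpNormEssSup (f := bdryValue s g)
      (μ := (bdryMeasure s).restrict (sphere 0 r))] with ζ hζ
    rw [← ENNReal.ofReal_le_ofReal_iff hK, ofReal_norm]
    exact hζ.trans h
  rw [ae_restrict_iff' isClosed_sphere.measurableSet] at hsphere
  filter_upwards [ae_circleMap_of_ae_circleMeasure
    (ae_mono (circleMeasure_le_bdryMeasure hr) hsphere)] with θ hθ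
  exact hθ (circleMap_mem_sphere 0 hr0 θ)

theorem supNorm_inter_sphere_le (hr : r = s ∨ r = 1) {g : ℂ → ℂ} {B : ℝ}
    (h : ∀ ζ ∈ sphere (0 : ℂ) r, ‖bdryValue s g ζ‖ ≤ B) :
    supNorm s (bdry s ∩ sphere 0 r) g ≤ ENNReal.ofReal B := by
  rw [supNorm, eLpNorm_exponent_top]
  refine eLpNormEssSup_le_of_ae_bound ?_
  rw [inter_eq_right.mpr (sphere_subset_bdry hr), ae_restrict_iff' isClosed_sphere.measurableSet]
  exact .of_forall h

theorem bdryValue_congr {f g : ℂ → ℂ} (h : EqOn f g (annulus s)) (ζ : ℂ) :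
    bdryValue s f ζ = bdryValue s g ζ :=
  congrArg lim <| map_congr <| by filter_upwards [self_mem_nhdsWithin] with r hr using h hr

theorem forall_norm_comp_circleMap_le {F : ℂ → ℂ} (hF : Continuous F) {K : ℝ}
    (h : ∀ᵐ θ : ℝ, ‖F (circleMap 0 r θ)‖ ≤ K) (θ : ℝ) : ‖F (circleMap 0 r θ)‖ ≤ K := by
  have hclosed : IsClosed {θ : ℝ | ‖F (circleMap 0 r θ)‖ ≤ K} :=
    isClosed_le (hF.comp (continuous_circleMap 0 r)).norm continuous_const
  exact hclosed.closure_subset (Measure.dense_of_ae h θ)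

variable {k : ℕ} {f : ℂ → ℂ} {K : ℝ}

theorem MemHardySobolev.exists_lipschitzWith_eqOn (hs0 : 0 < s) (hf : MemHardySobolev s k f)
    {i : ℕ} (hi : i < k) :
    ∃ C F, LipschitzWith C F ∧ DifferentiableOn ℂ F (annulus s) ∧
      EqOn (iteratedDeriv i f) F (annulus s) := by
  have hd := (hf i hi.le).1
  obtain ⟨M, hM⟩ := (hf (i + 1) hi).2
  rw [iteratedDeriv_succ] at hM
  obtain ⟨C, hC⟩ := AnnulusHardy.exists_lipschitzWith_eqOn hs0 M
  obtain ⟨F, hF, heq⟩ := hC _ hd hM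
  exact ⟨C, F, hF, hd.congr heq.symm, heq⟩

theorem norm_iteratedDeriv_le (hs0 : 0 < s) (hs1 : s < 1) (hK : 0 ≤ K)
    (hf : MemHardySobolev s k f) (hfK : hardySobolevNorm s k (bdry s) f ≤ ENNReal.ofReal K)
    (hk : 0 < k) {i : ℕ} (hi : i ≤ k) {z : ℂ} (hz : z ∈ annulus s) :
    ‖iteratedDeriv i f z‖ ≤ K / s := by
  have hae : ∀ r, r = s ∨ r = 1 →
      ∀ᵐ θ : ℝ, ‖bdryValue s (iteratedDeriv i f) (circleMap 0 r θ)‖ ≤ K := by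
    have hsum := Finset.sup_le_iff.mp hfK i (Finset.mem_range_succ_iff.mpr hi)
    rintro r (rfl | rfl)
    · exact ae_norm_bdryValue_le hs0.le (.inl rfl) hK (le_self_add.trans hsum)
    · exact ae_norm_bdryValue_le zero_le_one (.inr rfl) hK (le_add_self.trans hsum)
  rcases hi.lt_or_eq with hik | rfl
  · obtain ⟨C, F, hF, hd, heq⟩ := hf.exists_lipschitzWith_eqOn hs0 hik
    rw [heq hz]
    refine (norm_le_of_norm_le_bdry ⟨hd, hF.continuous.continuousOn⟩ (fun ζ hζ => ?_)
      (subset_closure hz)).trans (le_div_self hK hs0 hs1.le)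
    obtain ⟨r, hr, hζr⟩ : ∃ r, (r = s ∨ r = 1) ∧ ‖ζ‖ = r := by simpa [bdry] using hζ
    have hr0 : 0 ≤ r := hζr ▸ norm_nonneg ζ
    have hcirc : circleMap 0 r ζ.arg = ζ := by
      rw [circleMap_zero, ← hζr, Complex.norm_mul_exp_arg_mul_I]
    rw [← hcirc]
    refine forall_norm_comp_circleMap_le hF.continuous ?_ _
    filter_upwards [hae r hr] with θ hθ
    rwa [bdryValue_eq_of_eqOn hs0 hs1 hF.continuous heq
      (sphere_subset_bdry hr (circleMap_mem_sphere 0 hr0 θ))] at hθ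
  · obtain ⟨n, rfl⟩ := Nat.exists_eq_succ_of_ne_zero hk.ne'
    obtain ⟨C, F, hF, hd, heq⟩ := hf.exists_lipschitzWith_eqOn hs0 n.lt_succ_self
    have hderiv : EqOn (iteratedDeriv (n + 1) f) (deriv F) (annulus s) := by
      rw [iteratedDeriv_succ]
      exact heq.deriv (isOpen_annulus s)
    rw [hderiv hz]
    refine norm_deriv_le_of_ae_norm_bdryValue_le hs0 hs1 hF hd (fun r hr => ?_) hz
    simpa only [bdryValue_congr hderiv] using hae r hr

end SobolevBounds

section Interpolation

variable {s : ℝ}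

theorem norm_add_mul_div_norm {z : ℂ} (hz : z ≠ 0) {t : ℝ} (ht : 0 ≤ ‖z‖ + t) :
    ‖z + t * (z / ‖z‖)‖ = ‖z‖ + t := by
  have hz' : (‖z‖ : ℂ) ≠ 0 := by exact_mod_cast norm_ne_zero_iff.mpr hz
  have heq : z + t * (z / ‖z‖) = ((‖z‖ + t : ℝ) : ℂ) * (z / ‖z‖) := by
    push_cast; field_simp
  rw [heq, norm_mul, norm_div, Complex.norm_real, Complex.norm_real, norm_norm,
    div_self (norm_ne_zero_iff.mpr hz), mul_one, Real.norm_of_nonneg ht]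

theorem exists_radial_segment (hs0 : 0 < s) {z : ℂ} (hz : z ∈ annulus s) :
    ∃ u : ℂ, ‖u‖ = 1 ∧ ∀ t ∈ Icc 0 ((1 - s) / 4),
      z + t * u ∈ annulus s ∧ t ≤ 1 - ‖z + t * u‖ ∧ t ≤ ‖z + t * u‖ - s := by
  have hz0 : z ≠ 0 := norm_pos_iff.mp (hs0.trans hz.1)
  have hu : ‖z / ‖z‖‖ = 1 := by simp [hz0]
  rcases le_total ‖z‖ ((1 + s) / 2) with h | h
  · refine ⟨z / ‖z‖, hu, fun t ht => ?_⟩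
    rw [annulus, mem_ofPred_eq, norm_add_mul_div_norm hz0 (by linarith [hz.1, ht.1])]
    refine ⟨⟨?_, ?_⟩, ?_, ?_⟩ <;> linarith [hz.1, hz.2, ht.1, ht.2]
  · refine ⟨-(z / ‖z‖), by rwa [norm_neg], fun t ht => ?_⟩
    have hneg : z + t * -(z / ‖z‖) = z + ((-t : ℝ) : ℂ) * (z / ‖z‖) := by push_cast; ring
    rw [annulus, mem_ofPred_eq, hneg,
      norm_add_mul_div_norm hz0 (by linarith [hz.1, hz.2, ht.2])]
    refine ⟨⟨?_, ?_⟩, ?_, ?_⟩ <;> linarith [hz.1, hz.2, ht.1, ht.2]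

theorem iteratedDerivWithin_comp_segment {U : Set ℂ} (hU : IsOpen U) {f : ℂ → ℂ}
    (hf : DifferentiableOn ℂ f U) {z u : ℂ} {ℓ : ℝ} (hℓ : 0 < ℓ)
    (hseg : ∀ t ∈ Icc 0 ℓ, z + t * u ∈ U) (i : ℕ) {t : ℝ} (ht : t ∈ Icc 0 ℓ) :
    iteratedDerivWithin i (fun t : ℝ => f (z + t * u)) (Icc 0 ℓ) t =
      u ^ i * iteratedDeriv i f (z + t * u) := by
  induction i generalizing t with
  | zero => simp
  | succ i ih =>
    have hcurve : HasDerivAt (fun t : ℝ => z + t * u) u t := by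
      simpa using ((hasDerivAt_id t).ofReal_comp.mul_const u).const_add z
    have hderiv : HasDerivAt (iteratedDeriv i f) (iteratedDeriv (i + 1) f (z + t * u))
        (z + t * u) := by
      have hanalytic : AnalyticAt ℂ f (z + t * u) := hf.analyticAt (hU.mem_nhds (hseg t ht))
      rw [iteratedDeriv_succ, iteratedDeriv_eq_iterate]
      exact (hanalytic.iterated_deriv i).differentiableAt.hasDerivAt
    rw [iteratedDerivWithin_succ, derivWithin_congr (fun x hx => ih hx) (ih ht)]
    have hcomp := ((hderiv.comp t hcurve).const_mul (u ^ i)).hasDerivWithinAt (s := Icc 0 ℓ)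
    rw [show (fun x : ℝ => u ^ i * iteratedDeriv i f (z + x * u)) =
      fun x : ℝ => u ^ i * (iteratedDeriv i f ∘ fun t : ℝ => z + t * u) x from rfl,
      hcomp.derivWithin (uniqueDiffOn_Icc hℓ t ht)]
    ring

theorem exists_norm_iteratedDeriv_le_mul_pow (hs0 : 0 < s) (hs1 : s < 1) (n : ℕ) {η₀ : ℝ}
    (hη₀ : 0 < η₀) (K : ℝ) :
    ∃ A > 0, ∀ f : ℂ → ℂ, DifferentiableOn ℂ f (annulus s) →
      (∀ z ∈ annulus s, ‖iteratedDeriv (n + 1) f z‖ ≤ K) →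
      ∀ η, 0 < η → η ≤ η₀ → (∀ z ∈ annulus s, ‖f z‖ ≤ η ^ (n + 1)) →
      ∀ i ≤ n + 1, ∀ z ∈ annulus s, ‖iteratedDeriv i f z‖ ≤ A * η ^ (n + 1 - i) := by
  have hℓ : 0 < (1 - s) / 4 := by linarith
  obtain ⟨A, hA, hle⟩ := exists_norm_iteratedDerivWithin_le (E := ℂ) n hℓ hη₀ K
  refine ⟨max A K, hA.trans_le (le_max_left _ _), fun f hf hfK η hη hηη₀ hfη i hi z hz => ?_⟩
  rcases hi.eq_or_lt with rfl | hi
  · simpa using .inr (hfK z hz)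
  obtain ⟨u, hu, hseg⟩ := exists_radial_segment hs0 hz
  have hmem : ∀ t ∈ Icc 0 ((1 - s) / 4), z + t * u ∈ annulus s := fun t ht => (hseg t ht).1
  have hcont : ContDiffOn ℝ (n + 1) (fun t : ℝ => f (z + t * u)) (Icc 0 ((1 - s) / 4)) :=
    ((hf.contDiffOn (isOpen_annulus s)).restrict_scalars ℝ).comp
      (contDiff_const.add (Complex.ofRealCLM.contDiff.mul contDiff_const)).contDiffOn hmem
  have hnorm : ∀ i, ∀ t ∈ Icc 0 ((1 - s) / 4),
      ‖iteratedDerivWithin i (fun t : ℝ => f (z + t * u)) (Icc 0 ((1 - s) / 4)) t‖ =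
        ‖iteratedDeriv i f (z + t * u)‖ := fun i t ht => by
    rw [iteratedDerivWithin_comp_segment (isOpen_annulus s) hf hℓ hmem i ht, norm_mul, norm_pow, hu,
      one_pow, one_mul]
  have hA' := hle _ hcont (fun t ht => (hnorm _ t ht).trans_le (hfK _ (hmem t ht))) η hη hηη₀
    (fun t ht => hfη _ (hmem t ht)) i (Nat.lt_succ_iff.mp hi)
  rw [hnorm i 0 (left_mem_Icc.mpr hℓ.le), Complex.ofReal_zero, zero_mul, add_zero] at hA'
  exact hA'.trans (by gcongr; exact le_max_left _ _)

end Interpolation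

section Arcs

variable {s r : ℝ}

instance isProbabilityMeasure_circleMeasure : IsProbabilityMeasure (circleMeasure r) := by
  refine ⟨?_⟩
  rw [circleMeasure, Measure.map_apply (measurable_circleMap 0 r) .univ, preimage_univ,
    Measure.smul_apply, Measure.restrict_apply_univ, Real.volume_Ioc, smul_eq_mul,
    ← ENNReal.ofReal_mul (by positivity), sub_zero, one_div_mul_cancel (by positivity),
    ENNReal.ofReal_one]

instance isFiniteMeasure_bdryMeasure : IsFiniteMeasure (bdryMeasure s) := by
  unfold bdryMeasure
  infer_instance

theorem bdryMeasure_le_two (I : Set ℂ) : bdryMeasure s I ≤ 2 := by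
  rw [bdryMeasure, Measure.add_apply, ← one_add_one_eq_two]
  exact add_le_add prob_le_one prob_le_one

theorem circleMeasure_eq_map (r a : ℝ) :
    circleMeasure r = Measure.map (circleMap 0 r)
      (ENNReal.ofReal (1 / (2 * Real.pi)) • volume.restrict (Ioc a (a + 2 * Real.pi))) := by
  ext A hA
  have hpre := measurable_circleMap 0 r hA
  have hinv (g : AddSubgroup.zmultiples (2 * Real.pi)) :
      (fun θ => g +ᵥ θ) ⁻¹' (circleMap 0 r ⁻¹' A) = circleMap 0 r ⁻¹' A := by
    obtain ⟨_, n, rfl⟩ := g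
    ext θ
    simp only [mem_preimage, AddSubgroup.vadd_def, vadd_eq_add, zsmul_eq_mul]
    rw [add_comm, (periodic_circleMap 0 r).int_mul n θ]
  have hdomain := (isAddFundamentalDomain_Ioc Real.two_pi_pos 0).measure_set_eq
    (isAddFundamentalDomain_Ioc Real.two_pi_pos a) hpre hinv
  rw [zero_add] at hdomain
  simp only [circleMeasure, Measure.map_apply (measurable_circleMap 0 r) hA, Measure.smul_apply,
    Measure.restrict_apply hpre, hdomain]

theorem ae_mem_sphere_circleMeasure (hr : 0 ≤ r) : ∀ᵐ ζ ∂circleMeasure r, ζ ∈ sphere (0 : ℂ) r := by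
  refine (ae_map_iff (measurable_circleMap 0 r).aemeasurable
    isClosed_sphere.measurableSet).mpr (.of_forall fun θ => circleMap_mem_sphere 0 hr θ)

theorem ae_mem_bdry (hs0 : 0 ≤ s) : ∀ᵐ ζ ∂bdryMeasure s, ζ ∈ bdry s := by
  rw [bdryMeasure, ae_add_measure_iff]
  exact ⟨(ae_mem_sphere_circleMeasure hs0).mono fun _ h => .inl h,
    (ae_mem_sphere_circleMeasure zero_le_one).mono fun _ h => .inr h⟩

theorem circleMeasure_eq_zero_of_subset_sphere {r' : ℝ} (hr : 0 ≤ r) (hne : r ≠ r') {I : Set ℂ}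
    (hI : I ⊆ sphere 0 r') : circleMeasure r I = 0 := by
  rw [← nonpos_iff_eq_zero, ← ae_iff.mp (ae_mem_sphere_circleMeasure hr)]
  refine measure_mono fun z hz hzr => hne ?_
  rw [← mem_sphere_zero_iff_norm.mp hzr, mem_sphere_zero_iff_norm.mp (hI hz)]

theorem bdryMeasure_eq_circleMeasure (hs0 : 0 < s) (hs1 : s < 1) (hr : r = s ∨ r = 1) {I : Set ℂ}
    (hI : I ⊆ sphere 0 r) : bdryMeasure s I = circleMeasure r I := by
  rw [bdryMeasure, Measure.add_apply]
  rcases hr with rfl | rfl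
  · rw [circleMeasure_eq_zero_of_subset_sphere zero_le_one hs1.ne' hI, add_zero]
  · rw [circleMeasure_eq_zero_of_subset_sphere hs0.le hs1.ne hI, zero_add]

theorem exists_subset_sphere (hs1 : s < 1) {I : Set ℂ} (hI : IsPreconnected I)
    (hIb : I ⊆ bdry s) : ∃ r, (r = s ∨ r = 1) ∧ I ⊆ sphere 0 r := by
  have hcover : I ⊆ ball 0 ((s + 1) / 2) ∪ (closedBall 0 ((s + 1) / 2))ᶜ := fun z hz => by
    rcases hIb hz with h | h <;> rw [mem_sphere_zero_iff_norm] at h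
    · exact .inl (by rw [mem_ball_zero_iff]; linarith)
    · exact .inr (by rw [mem_compl_iff, mem_closedBall_zero_iff]; linarith)
  have hdisj : Disjoint (ball (0 : ℂ) ((s + 1) / 2)) (closedBall 0 ((s + 1) / 2))ᶜ :=
    disjoint_compl_right_iff_subset.mpr ball_subset_closedBall
  rcases hI.subset_or_subset isOpen_ball isClosed_closedBall.isOpen_compl hdisj hcover with h | h
  · refine ⟨s, .inl rfl, fun z hz => (hIb hz).resolve_right fun hz1 => ?_⟩
    have := mem_ball_zero_iff.mp (h hz)
    rw [mem_sphere_zero_iff_norm.mp hz1] at this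
    linarith
  · refine ⟨1, .inr rfl, fun z hz => (hIb hz).resolve_left fun hzs => h hz ?_⟩
    rw [mem_closedBall_zero_iff, mem_sphere_zero_iff_norm.mp hzs]
    linarith

theorem circleMeasure_image_circleMap (hr : r ≠ 0) {a : ℝ} {Θ : Set ℝ} (hΘ : MeasurableSet Θ)
    (hΘa : Θ ⊆ Ioc a (a + 2 * Real.pi)) :
    circleMeasure r (circleMap 0 r '' Θ) = ENNReal.ofReal (1 / (2 * Real.pi)) * volume Θ := by
  have hinj : InjOn (circleMap 0 r) (Ioc a (a + 2 * Real.pi)) := by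
    have h := injOn_circleMap_of_abs_sub_le (c := 0) hr (a := a) (b := a + 2 * Real.pi)
      (by rw [sub_add_cancel_left, abs_neg, abs_of_pos Real.two_pi_pos])
    rwa [uIoc_of_le (by linarith [Real.two_pi_pos])] at h
  have himage : MeasurableSet (circleMap 0 r '' Θ) :=
    hΘ.image_of_continuousOn_injOn (continuous_circleMap 0 r).continuousOn (hinj.mono hΘa)
  rw [circleMeasure_eq_map r a, Measure.map_apply (measurable_circleMap 0 r) himage,
    Measure.smul_apply, Measure.restrict_apply (measurable_circleMap 0 r himage), smul_eq_mul,
    hinj.preimage_image_inter hΘa]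

theorem isPreconnected_circleAngle_image (hr : 0 < r) {I : Set ℂ} (hI : IsPreconnected I)
    (hIr : I ⊆ sphere 0 r) {θ₀ : ℝ} (hθ₀ : circleMap 0 r (θ₀ + Real.pi) ∉ I) :
    IsPreconnected (circleAngle r θ₀ '' I) := by
  refine hI.image _ fun z hz => (continuousAt_circleAngle ?_).continuousWithinAt
  rw [Complex.mem_slitPlane_iff_arg, ← norm_ne_zero_iff, norm_div_circleMap hr θ₀ (hIr hz)]
  refine ⟨fun h => hθ₀ ?_, one_ne_zero⟩
  rwa [← h, ← circleAngle, circleMap_circleAngle hr θ₀ (hIr hz)]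

theorem exists_lt_sub_of_lt_volume {Θ : Set ℝ} {c : ℝ} (h : ENNReal.ofReal c < volume Θ) :
    ∃ x ∈ Θ, ∃ y ∈ Θ, c < y - x := by
  by_contra! hcon
  refine h.not_ge ((Real.volume_le_diam Θ).trans (ediam_le fun x hx y hy => ?_))
  rw [edist_dist, Real.dist_eq]
  exact ENNReal.ofReal_le_ofReal (abs_sub_le_iff.mpr ⟨hcon y hy x hx, hcon x hx y hy⟩)

theorem exists_forall_circleMap_mem (hr : 0 < r) {I : Set ℂ} (hI : IsConnected I)
    (hIr : I ⊆ sphere 0 r) {lam : ℝ} (hlam : 0 < lam)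
    (hμ : ENNReal.ofReal lam ≤ circleMeasure r I) :
    ∃ α, ∀ θ ∈ Icc α (α + Real.pi * lam), circleMap 0 r θ ∈ I := by
  by_cases hfull : ∀ θ, circleMap 0 r θ ∈ I
  · exact ⟨0, fun θ _ => hfull θ⟩
  push Not at hfull
  obtain ⟨b, hb⟩ := hfull
  obtain ⟨θ₀, rfl⟩ : ∃ θ₀, b = θ₀ + Real.pi := ⟨b - Real.pi, by ring⟩
  set Θ := circleAngle r θ₀ '' I
  have hΘ : Θ.OrdConnected :=
    (isPreconnected_circleAngle_image hr hI.isPreconnected hIr hb).ordConnected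
  have hΘ_sub : Θ ⊆ Ioc (θ₀ - Real.pi) (θ₀ - Real.pi + 2 * Real.pi) := by
    rintro _ ⟨z, -, rfl⟩
    have harg := Complex.arg_mem_Ioc (z / circleMap 0 r θ₀)
    unfold circleAngle
    constructor <;> linarith [harg.1, harg.2]
  have himage : circleMap 0 r '' Θ = I := by
    rw [image_image, image_congr fun z hz => circleMap_circleAngle hr θ₀ (hIr hz), image_id']
  have hvol : ENNReal.ofReal (Real.pi * lam) < volume Θ := by
    rw [← himage, circleMeasure_image_circleMap hr.ne' hΘ.measurableSet hΘ_sub] at hμ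
    by_contra! hle
    refine hμ.not_gt ?_
    calc ENNReal.ofReal (1 / (2 * Real.pi)) * volume Θ
        ≤ ENNReal.ofReal (1 / (2 * Real.pi)) * ENNReal.ofReal (Real.pi * lam) := by gcongr
      _ = ENNReal.ofReal (lam / 2) := by
          rw [← ENNReal.ofReal_mul (by positivity)]
          congr 1
          field_simp
      _ < ENNReal.ofReal lam := (ENNReal.ofReal_lt_ofReal_iff hlam).mpr (half_lt_self hlam)
  obtain ⟨x, hx, y, hy, hxy⟩ := exists_lt_sub_of_lt_volume hvol
  exact ⟨x, fun θ hθ => himage ▸ mem_image_of_mem _ (hΘ.out hx hy ⟨hθ.1, by linarith [hθ.2]⟩)⟩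

theorem map_circleMap_Ioc_le (hr : r = s ∨ r = 1) {I : Set ℂ} {α β : ℝ}
    (hβ : β ≤ α + 2 * Real.pi) (hI : ∀ θ ∈ Icc α β, circleMap 0 r θ ∈ I) :
    Measure.map (circleMap 0 r) (ENNReal.ofReal (1 / (2 * Real.pi)) •
      volume.restrict (Ioc α β)) ≤ (bdryMeasure s).restrict I := by
  set J := circleMap 0 r '' Icc α β
  have hJm : MeasurableSet J := (isCompact_Icc.image (continuous_circleMap 0 r)).measurableSet
  set ν := Measure.map (circleMap 0 r) (ENNReal.ofReal (1 / (2 * Real.pi)) •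
      volume.restrict (Ioc α β))
  have hνJ : ∀ᵐ ζ ∂ν, ζ ∈ J := by
    refine (ae_map_iff (measurable_circleMap 0 r).aemeasurable hJm).mpr ?_
    refine Measure.ae_smul_measure ?_ _
    filter_upwards [ae_restrict_mem measurableSet_Ioc] with θ hθ
    exact mem_image_of_mem _ (Ioc_subset_Icc_self hθ)
  have hν : ν ≤ bdryMeasure s := by
    refine le_trans ?_ (circleMeasure_le_bdryMeasure hr)
    rw [circleMeasure_eq_map r α]
    refine Measure.map_mono (Measure.le_iff'.mpr fun A => ?_) (measurable_circleMap 0 r)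
    simp only [Measure.smul_apply]
    gcongr
  rw [← Measure.restrict_eq_self_of_ae_mem hνJ]
  exact Measure.restrict_mono (image_subset_iff.mpr hI) hν

theorem integral_comp_circleMap_le (hs0 : 0 ≤ s) (hr : r = s ∨ r = 1) {I : Set ℂ}
    {α β : ℝ} (hαβ : α ≤ β) (hβ : β ≤ α + 2 * Real.pi)
    (hI : ∀ θ ∈ Icc α β, circleMap 0 r θ ∈ I) {F : ℂ → ℂ} (hF : Continuous F) :
    ∫ θ in α..β, ‖F (circleMap 0 r θ)‖ ≤ 2 * Real.pi * ∫ ζ in I, ‖F ζ‖ ∂bdryMeasure s := by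
  have hbdry : (bdryMeasure s).restrict (bdry s) = bdryMeasure s :=
    Measure.restrict_eq_self_of_ae_mem (ae_mem_bdry hs0)
  have hint : Integrable (fun ζ => ‖F ζ‖) (bdryMeasure s) := by
    rw [← hbdry]
    exact hF.norm.continuousOn.integrableOn_compact
      ((isCompact_sphere 0 s).union (isCompact_sphere 0 1))
  have hle := integral_mono_measure (map_circleMap_Ioc_le hr hβ hI)
    (.of_forall fun ζ => norm_nonneg (F ζ)) hint.restrict
  rw [integral_map (measurable_circleMap 0 r).aemeasurable hF.norm.aestronglyMeasurable,
    integral_smul_measure, ENNReal.toReal_ofReal (by positivity), smul_eq_mul,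
    ← intervalIntegral.integral_of_le hαβ, one_div_mul_eq_div, div_le_iff₀' (by positivity)] at hle
  exact hle

end Arcs

section ArcEstimate

variable {s r : ℝ}

theorem sq_le_mul_integral {φ : ℝ → ℝ} {M : NNReal} (hφ : LipschitzWith M φ) (h0 : ∀ x, 0 ≤ φ x)
    {B ℓ : ℝ} (hB : 0 < B) (hℓ : 0 < ℓ) {α θ : ℝ} (hθ : θ ∈ Icc α (α + ℓ)) (hθB : φ θ ≤ B) :
    φ θ ^ 2 ≤ 4 * (M + B / ℓ) * ∫ x in α..α + ℓ, φ x := by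
  set d := φ θ / (2 * (M + B / ℓ))
  have hd : (M + B / ℓ) * d = φ θ / 2 := by
    simp only [d]
    field_simp
  have hd0 : 0 ≤ d := div_nonneg (h0 θ) (by positivity)
  have hdℓ : d ≤ ℓ / 2 := by
    have hle : B / ℓ * d ≤ B / 2 := by nlinarith [M.coe_nonneg]
    rwa [div_mul_eq_mul_div, div_le_iff₀ hℓ, div_mul_eq_mul_div, mul_div_assoc,
      mul_le_mul_iff_right₀ hB] at hle
  obtain ⟨u, hu, hud, huθ, hθu⟩ : ∃ u, α ≤ u ∧ u + d ≤ α + ℓ ∧ u ≤ θ ∧ θ ≤ u + d := by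
    rcases le_total θ (α + ℓ / 2) with h | h
    · exact ⟨θ, hθ.1, by linarith, le_rfl, by linarith⟩
    · exact ⟨θ - d, by linarith, by linarith [hθ.2], by linarith, by linarith⟩
  have hlow : ∀ x ∈ Icc u (u + d), φ θ / 2 ≤ φ x := fun x hx => by
    have hdist : |θ - x| ≤ d := abs_le.mpr ⟨by linarith [hx.2], by linarith [hx.1]⟩
    have hlip : φ θ - φ x ≤ M * |θ - x| := (le_abs_self _).trans (hφ.dist_le_mul θ x)
    have hle : M * |θ - x| ≤ M * d := by gcongr
    have : 0 ≤ B / ℓ * d := by positivity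
    linarith
  have hsub : d * (φ θ / 2) ≤ ∫ x in u..u + d, φ x := by
    have h := intervalIntegral.integral_mono_on (μ := volume) (f := fun _ => φ θ / 2) (g := φ)
      (le_add_of_nonneg_right hd0) (by simp) (hφ.continuous.intervalIntegrable _ _) hlow
    rwa [intervalIntegral.integral_const, smul_eq_mul, add_sub_cancel_left] at h
  have hmono : ∫ x in u..u + d, φ x ≤ ∫ x in α..α + ℓ, φ x :=
    intervalIntegral.integral_mono_interval hu (by linarith) hud
      (.of_forall h0) (hφ.continuous.intervalIntegrable _ _)
  calc φ θ ^ 2 = 4 * (M + B / ℓ) * (d * (φ θ / 2)) := by linear_combination (-2 * φ θ) * hd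
    _ ≤ 4 * (M + B / ℓ) * ∫ x in α..α + ℓ, φ x := by gcongr; exact hsub.trans hmono

theorem l1Norm_nonneg (s : ℝ) (I : Set ℂ) (f : ℂ → ℂ) : 0 ≤ l1Norm s I f :=
  mul_nonneg (inv_nonneg.mpr ENNReal.toReal_nonneg) (integral_nonneg fun _ => norm_nonneg _)

theorem setIntegral_norm_le_two_mul_l1Norm (hs0 : 0 < s) (hs1 : s < 1) {I : Set ℂ}
    {f F : ℂ → ℂ} (hF : Continuous F) (hfF : EqOn f F (annulus s)) :
    ∫ ζ in I, ‖F ζ‖ ∂bdryMeasure s ≤ 2 * l1Norm s I f := by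
  have hae : ∀ᵐ ζ ∂(bdryMeasure s).restrict I, ‖bdryValue s f ζ‖ = ‖F ζ‖ := by
    filter_upwards [ae_restrict_of_ae (ae_mem_bdry hs0.le)] with ζ hζ
    rw [bdryValue_eq_of_eqOn hs0 hs1 hF hfF hζ]
  rw [← integral_congr_ae hae]
  rcases eq_or_ne (bdryMeasure s I) 0 with hμ | hμ
  · rw [Measure.restrict_eq_zero.mpr hμ, integral_zero_measure]
    exact mul_nonneg zero_le_two (l1Norm_nonneg s I f)
  · have hreal : 0 < (bdryMeasure s I).toReal := ENNReal.toReal_pos hμ (measure_ne_top _ _)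
    have htwo : (bdryMeasure s I).toReal ≤ 2 :=
      ENNReal.toReal_mono ENNReal.ofNat_ne_top (bdryMeasure_le_two I)
    calc ∫ ζ in I, ‖bdryValue s f ζ‖ ∂bdryMeasure s
        = (bdryMeasure s I).toReal * l1Norm s I f := by
          rw [l1Norm, mul_inv_cancel_left₀ hreal.ne']
      _ ≤ 2 * l1Norm s I f := mul_le_mul_of_nonneg_right htwo (l1Norm_nonneg s I f)

theorem exists_norm_sq_le_mul_l1Norm (hs0 : 0 < s) (hs1 : s < 1) {ℓ : ℝ} (hℓ : 0 < ℓ)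
    (hℓ2 : ℓ ≤ 2 * Real.pi) (C : NNReal) {B : ℝ} (hB : 0 < B) :
    ∃ A > 0, ∀ f F : ℂ → ℂ, LipschitzWith C F → EqOn f F (annulus s) →
      (∀ z ∈ bdry s, ‖F z‖ ≤ B) → ∀ r, r = s ∨ r = 1 → ∀ I α,
      (∀ θ ∈ Icc α (α + ℓ), circleMap 0 r θ ∈ I) →
      ∀ θ ∈ Icc α (α + ℓ), ‖F (circleMap 0 r θ)‖ ^ 2 ≤ A * l1Norm s I f := by
  refine ⟨4 * (C + B / ℓ) * (4 * Real.pi), by positivity, ?_⟩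
  intro f F hF hfF hFB r hr I α hI θ hθ
  have hr0 : 0 ≤ r := by rcases hr with rfl | rfl; exacts [hs0.le, zero_le_one]
  have hr1 : r ≤ 1 := by rcases hr with rfl | rfl; exacts [hs1.le, le_rfl]
  have hφ : LipschitzWith C fun θ => ‖F (circleMap 0 r θ)‖ := by
    have h := lipschitzWith_one_norm.comp (hF.comp (lipschitzWith_circleMap 0 r))
    have hr_le : Real.nnabs r ≤ 1 := by
      rw [← NNReal.coe_le_coe, Real.coe_nnabs, abs_of_nonneg hr0, NNReal.coe_one]
      exact hr1
    exact h.weaken (by rw [one_mul]; exact mul_le_of_le_one_right' hr_le)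
  have hθB : ‖F (circleMap 0 r θ)‖ ≤ B :=
    hFB _ (sphere_subset_bdry hr (circleMap_mem_sphere 0 hr0 θ))
  have harc := integral_comp_circleMap_le hs0.le hr (by linarith) (by linarith) hI hF.continuous
  have hl1 := setIntegral_norm_le_two_mul_l1Norm hs0 hs1 (I := I) hF.continuous hfF
  calc ‖F (circleMap 0 r θ)‖ ^ 2
      ≤ 4 * (C + B / ℓ) * ∫ x in α..α + ℓ, ‖F (circleMap 0 r x)‖ :=
        sq_le_mul_integral hφ (fun _ => norm_nonneg _) hB hℓ hθ hθB
    _ ≤ 4 * (C + B / ℓ) * (2 * Real.pi * (2 * l1Norm s I f)) := by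
        gcongr
        exact harc.trans (by gcongr)
    _ = 4 * (C + B / ℓ) * (4 * Real.pi) * l1Norm s I f := by ring

end ArcEstimate

section TwoConstants

variable {s : ℝ}

theorem norm_le_mul_exp_of_strip {G : ℂ → ℂ} {l u m a b : ℝ} (hlu : l < u) (hm : 0 < m)
    (hG : DiffContOnCl ℂ G (Complex.re ⁻¹' Ioo l u)) (hGm : ∀ v, v.re ∈ Icc l u → ‖G v‖ ≤ m)
    (hl : ∀ v, v.re = l → ‖G v‖ ≤ m * Real.exp (-a))
    (hu : ∀ v, v.re = u → ‖G v‖ ≤ m * Real.exp (-b)) {v : ℂ} (hv : v.re ∈ Icc l u) :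
    ‖G v‖ ≤ m * Real.exp (-((a * (u - v.re) + b * (v.re - l)) / (u - l))) := by
  have hbdd : BddAbove ((norm ∘ G) '' Complex.HadamardThreeLines.verticalClosedStrip l u) :=
    ⟨m, by rintro _ ⟨w, hw, rfl⟩; exact hGm w hw⟩
  refine (Complex.HadamardThreeLines.norm_le_interp_of_mem_verticalClosedStrip' hlu hv hG hbdd
    hl hu).trans_eq ?_
  have hlu' : u - l ≠ 0 := (sub_pos.mpr hlu).ne'
  rw [Real.mul_rpow hm.le (Real.exp_nonneg _), Real.mul_rpow hm.le (Real.exp_nonneg _),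
    mul_mul_mul_comm, ← Real.rpow_add hm, sub_add_cancel, Real.rpow_one, ← Real.exp_mul,
    ← Real.exp_mul, ← Real.exp_add]
  congr 2
  field_simp
  ring

theorem mem_closure_annulus (hs0 : 0 < s) (hs1 : s < 1) {z : ℂ} (hz : ‖z‖ ∈ Icc s 1) :
    z ∈ closure (annulus s) := by
  rcases hz.1.eq_or_lt with h | h
  · exact bdry_subset_closure_annulus hs0 hs1 (.inl (mem_sphere_zero_iff_norm.mpr h.symm))
  rcases hz.2.eq_or_lt with h' | h'
  · exact bdry_subset_closure_annulus hs0 hs1 (.inr (mem_sphere_zero_iff_norm.mpr h'))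
  · exact subset_closure ⟨h, h'⟩

theorem norm_le_of_norm_le_annulus (hs0 : 0 < s) (hs1 : s < 1) {F : ℂ → ℂ} (hF : Continuous F)
    {m : ℝ} (hm : ∀ z ∈ annulus s, ‖F z‖ ≤ m) {z : ℂ} (hz : ‖z‖ ∈ Icc s 1) : ‖F z‖ ≤ m :=
  (isClosed_le hF.norm continuous_const).closure_subset_iff.mpr hm (mem_closure_annulus hs0 hs1 hz)

theorem norm_le_mul_exp_of_circles (hs0 : 0 < s) (hs1 : s < 1) {F : ℂ → ℂ} (hF : Continuous F)
    (hd : DifferentiableOn ℂ F (annulus s)) {m : ℝ} (hm0 : 0 < m)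
    (hm : ∀ z ∈ annulus s, ‖F z‖ ≤ m) {l u a b : ℝ} (hsl : Real.log s ≤ l) (hlu : l < u)
    (hu0 : u ≤ 0) (hl : ∀ z : ℂ, ‖z‖ = Real.exp l → ‖F z‖ ≤ m * Real.exp (-a))
    (hu : ∀ z : ℂ, ‖z‖ = Real.exp u → ‖F z‖ ≤ m * Real.exp (-b)) {z : ℂ} (hz0 : z ≠ 0)
    (hz : Real.log ‖z‖ ∈ Icc l u) :
    ‖F z‖ ≤ m * Real.exp (-((a * (u - Real.log ‖z‖) + b * (Real.log ‖z‖ - l)) / (u - l))) := by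
  have hG : DiffContOnCl ℂ (fun v => F (Complex.exp v)) (Complex.re ⁻¹' Ioo l u) :=
    ⟨hd.comp Complex.differentiable_exp.differentiableOn fun _ hv =>
      (exp_mem_annulus_iff hs0).mpr ⟨hsl.trans_lt hv.1, hv.2.trans_le hu0⟩,
      (hF.comp Complex.continuous_exp).continuousOn⟩
  have hGm (v : ℂ) (hv : v.re ∈ Icc l u) : ‖F (Complex.exp v)‖ ≤ m := by
    refine norm_le_of_norm_le_annulus hs0 hs1 hF hm ?_
    rw [Complex.norm_exp]
    exact ⟨(Real.log_le_iff_le_exp hs0).mp (hsl.trans hv.1),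
      Real.exp_le_one_iff.mpr (hv.2.trans hu0)⟩
  have h := norm_le_mul_exp_of_strip hlu hm0 hG hGm
    (fun v hv => hl _ (by rw [Complex.norm_exp, hv]))
    (fun v hv => hu _ (by rw [Complex.norm_exp, hv])) (v := Complex.log z) (by rwa [Complex.log_re])
  rwa [Complex.exp_log hz0, Complex.log_re] at h

theorem norm_le_of_norm_le_sqrt_circle (hs0 : 0 < s) (hs1 : s < 1) {F : ℂ → ℂ}
    (hF : Continuous F) (hd : DifferentiableOn ℂ F (annulus s)) {m κ : ℝ} (hm0 : 0 < m)
    (hm : ∀ z ∈ annulus s, ‖F z‖ ≤ m) (hκ : 0 ≤ κ)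
    (hmid : ∀ z : ℂ, ‖z‖ = √s → ‖F z‖ ≤ m * Real.exp (-κ)) {z : ℂ} (hz : z ∈ annulus s) {t : ℝ}
    (ht1 : t ≤ 1 - ‖z‖) (hts : t ≤ ‖z‖ - s) : ‖F z‖ ≤ m * Real.exp (-(2 * κ * t / q0 s)) := by
  have hq : 0 < -Real.log s := neg_pos.mpr (Real.log_neg hs0 hs1)
  have hz0 : 0 < ‖z‖ := hs0.trans hz.1
  have hcircle {x : ℝ} (hx : Real.log s ≤ x) (hx0 : x ≤ 0) (z : ℂ) (hz : ‖z‖ = Real.exp x) :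
      ‖F z‖ ≤ m * Real.exp (-0) := by
    rw [neg_zero, Real.exp_zero, mul_one]
    refine norm_le_of_norm_le_annulus hs0 hs1 hF hm ?_
    rw [hz]
    exact ⟨(Real.log_le_iff_le_exp hs0).mp hx, Real.exp_le_one_iff.mpr hx0⟩
  have hsqrt : Real.exp (Real.log s / 2) = √s := by
    rw [Real.sqrt_eq_rpow, Real.rpow_def_of_pos hs0, mul_one_div]
  rw [← hsqrt] at hmid
  rw [q0]
  rcases le_total (Real.log ‖z‖) (Real.log s / 2) with hle | hle
  · have hlog : t ≤ Real.log ‖z‖ - Real.log s := by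
      have h := Real.one_sub_inv_le_log_of_pos (div_pos hz0 hs0)
      rw [Real.log_div hz0.ne' hs0.ne', inv_div] at h
      have : s / ‖z‖ ≤ 1 - (‖z‖ - s) := by
        rw [div_le_iff₀ hz0]; nlinarith [hz.1, hz.2]
      linarith
    refine (norm_le_mul_exp_of_circles hs0 hs1 hF hd hm0 hm le_rfl (by linarith) (by linarith)
      (hcircle le_rfl (by linarith)) hmid (norm_pos_iff.mp hz0)
      ⟨Real.log_le_log hs0 hz.1.le, hle⟩).trans ?_
    gcongr m * Real.exp (-?_)
    rw [div_le_div_iff₀ hq (by linarith)]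
    linear_combination (-Real.log s * κ) * hlog
  · have hlog : t ≤ -Real.log ‖z‖ := by linarith [Real.log_le_sub_one_of_pos hz0]
    refine (norm_le_mul_exp_of_circles hs0 hs1 hF hd hm0 hm (by linarith) (by linarith) le_rfl
      hmid (hcircle (by linarith) le_rfl) (norm_pos_iff.mp hz0)
      ⟨hle, Real.log_nonpos hz0.le hz.2.le⟩).trans ?_
    gcongr m * Real.exp (-?_)
    rw [div_le_div_iff₀ hq (by linarith)]
    linear_combination (-Real.log s * κ) * hlog

theorem norm_circleMap_mul_exp {r : ℝ} (hr : 0 < r) (θ σ : ℝ) (v : ℂ) :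
    ‖circleMap 0 r θ * Complex.exp (σ * v)‖ = Real.exp (Real.log r + σ * v.re) := by
  rw [norm_mul, Complex.norm_exp, Complex.re_ofReal_mul, norm_circleMap_zero, abs_of_pos hr,
    Real.exp_add, Real.exp_log hr]

theorem circleMap_mul_exp_of_re_eq_zero (r θ σ : ℝ) {v : ℂ} (hv : v.re = 0) :
    circleMap 0 r θ * Complex.exp (σ * v) = circleMap 0 r (θ + σ * v.im) := by
  have hvI : v = v.im * Complex.I := by simpa [hv] using (Complex.re_add_im v).symm
  rw [circleMap_zero, circleMap_zero, Complex.ofReal_add, add_mul, Complex.exp_add, ← mul_assoc,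
    Complex.ofReal_mul, mul_assoc (σ : ℂ), ← hvI]

theorem exists_circleMap_mul_exp_eq {r σ : ℝ} (hr : 0 < r) (hσ : σ = 1 ∨ σ = -1) (θ : ℝ) {z : ℂ}
    (hz : z ≠ 0) : ∃ v : ℂ, v.re = σ * (Real.log ‖z‖ - Real.log r) ∧ |v.im| ≤ Real.pi ∧
      circleMap 0 r θ * Complex.exp (σ * v) = z := by
  have hζ : circleMap 0 r θ ≠ 0 := circleMap_ne_center hr.ne'
  refine ⟨σ * Complex.log (z / circleMap 0 r θ), ?_, ?_, ?_⟩
  · rw [Complex.re_ofReal_mul, Complex.log_re, norm_div, norm_circleMap_zero, abs_of_pos hr,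
      Real.log_div (norm_ne_zero_iff.mpr hz) hr.ne']
  · rw [Complex.im_ofReal_mul, Complex.log_im]
    have := Complex.abs_arg_le_pi (z / circleMap 0 r θ)
    rcases hσ with rfl | rfl <;> simpa using this
  · have hσσ : σ * σ = 1 := by rcases hσ with rfl | rfl <;> norm_num
    rw [← mul_assoc, ← Complex.ofReal_mul, hσσ, Complex.ofReal_one, one_mul,
      Complex.exp_log (div_ne_zero hz hζ), mul_div_cancel₀ _ hζ]

theorem exists_two_constants_sqrt_circle (hs0 : 0 < s) (hs1 : s < 1) {ℓ : ℝ} (hℓ : 0 < ℓ) :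
    ∃ c > 0, ∀ (F : ℂ → ℂ) (m δ r α : ℝ), Continuous F → DifferentiableOn ℂ F (annulus s) →
      (∀ z ∈ annulus s, ‖F z‖ ≤ m) → (r = s ∨ r = 1) →
      (∀ θ ∈ Icc α (α + ℓ), ‖F (circleMap 0 r θ)‖ ≤ δ) → 0 < δ → δ ≤ m →
      ∀ z : ℂ, ‖z‖ = √s → ‖F z‖ ≤ m * Real.exp (-(c * Real.log (m / δ))) := by
  have hq : 0 < q0 s := neg_pos.mpr (Real.log_neg hs0 hs1)
  obtain ⟨c, hc, h⟩ := exists_two_constants_strip hq (half_pos hℓ) Real.pi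
  refine ⟨c, hc, fun F m δ r α hF hd hm hr hδ hδ0 hδm z hz => ?_⟩
  have hr0 : 0 < r := by rcases hr with rfl | rfl; exacts [hs0, one_pos]
  -- `v ↦ ζ * exp (σ * v)` maps the strip `0 < re v < q₀` to the annulus and `0` to the midpoint `ζ`
  -- of the arc, so that the strip is always entered from the circle of radius `r`.
  obtain ⟨σ, hσ, hlogr⟩ : ∃ σ : ℝ, (σ = 1 ∨ σ = -1) ∧ Real.log r = -((1 + σ) / 2 * q0 s) := by
    rcases hr with rfl | rfl
    exacts [⟨1, .inl rfl, by norm_num [q0]⟩, ⟨-1, .inr rfl, by norm_num⟩]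
  have hlogs : Real.log s = -q0 s := by rw [q0, neg_neg]
  set ζ := circleMap 0 r (α + ℓ / 2)
  have hnorm (v : ℂ) : ‖ζ * Complex.exp (σ * v)‖ = Real.exp (Real.log r + σ * v.re) :=
    norm_circleMap_mul_exp hr0 _ _ v
  have hmaps (v : ℂ) (hv : v.re ∈ Ioo 0 (q0 s)) : ζ * Complex.exp (σ * v) ∈ annulus s := by
    change _ ∧ _
    rw [hnorm, ← Real.log_lt_iff_lt_exp hs0, Real.exp_lt_one_iff, hlogr, hlogs]
    rcases hσ with rfl | rfl <;> constructor <;> linarith [hv.1, hv.2]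
  have hbound (v : ℂ) (hv : v.re ∈ Icc 0 (q0 s)) : ‖F (ζ * Complex.exp (σ * v))‖ ≤ m := by
    refine norm_le_of_norm_le_annulus hs0 hs1 hF hm ?_
    rw [hnorm, mem_Icc, ← Real.log_le_iff_le_exp hs0, Real.exp_le_one_iff, hlogr, hlogs]
    rcases hσ with rfl | rfl <;> constructor <;> linarith [hv.1, hv.2]
  have harc (v : ℂ) (hv : v.re = 0) (him : |v.im| ≤ ℓ / 2) :
      ‖F (ζ * Complex.exp (σ * v))‖ ≤ δ := by
    rw [circleMap_mul_exp_of_re_eq_zero _ _ _ hv]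
    rw [abs_le] at him
    refine hδ _ ?_
    rcases hσ with rfl | rfl <;> constructor <;> linarith
  have hdiff : DiffContOnCl ℂ (fun v : ℂ => F (ζ * Complex.exp (σ * v)))
      (Complex.re ⁻¹' Ioo 0 (q0 s)) :=
    ⟨hd.comp (by fun_prop) hmaps, (hF.comp (by fun_prop)).continuousOn⟩
  have hz0 : z ≠ 0 := norm_ne_zero_iff.mp (hz ▸ (Real.sqrt_pos.mpr hs0).ne')
  obtain ⟨v, hre, him, rfl⟩ := exists_circleMap_mul_exp_eq hr0 hσ (α + ℓ / 2) hz0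
  refine h _ δ m hdiff hbound harc hδ0 hδm v ?_ him
  rw [hre, hz, Real.log_sqrt hs0.le, hlogr, hlogs]
  rcases hσ with rfl | rfl <;> ring

theorem exists_two_constants_annulus (hs0 : 0 < s) (hs1 : s < 1) {ℓ : ℝ} (hℓ : 0 < ℓ) :
    ∃ c > 0, ∀ (F : ℂ → ℂ) (m δ r α : ℝ), Continuous F → DifferentiableOn ℂ F (annulus s) →
      (∀ z ∈ annulus s, ‖F z‖ ≤ m) → (r = s ∨ r = 1) →
      (∀ θ ∈ Icc α (α + ℓ), ‖F (circleMap 0 r θ)‖ ≤ δ) → 0 < δ → δ ≤ m →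
      ∀ z ∈ annulus s, ∀ t, t ≤ 1 - ‖z‖ → t ≤ ‖z‖ - s →
        ‖F z‖ ≤ m * Real.exp (-(c * t * Real.log (m / δ))) := by
  have hq : 0 < q0 s := neg_pos.mpr (Real.log_neg hs0 hs1)
  obtain ⟨c, hc, h⟩ := exists_two_constants_sqrt_circle hs0 hs1 hℓ
  refine ⟨2 * c / q0 s, by positivity, ?_⟩
  intro F m δ r α hF hd hm hr hδ hδ0 hδm z hz t ht1 hts
  have hlog : 0 ≤ Real.log (m / δ) := Real.log_nonneg ((one_le_div hδ0).mpr hδm)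
  refine (norm_le_of_norm_le_sqrt_circle hs0 hs1 hF hd (hδ0.trans_le hδm) hm (by positivity)
    (h F m δ r α hF hd hm hr hδ hδ0 hδm) hz ht1 hts).trans_eq ?_
  ring_nf

end TwoConstants

section Decay

variable {s ℓ K : ℝ}

theorem exp_neg_le_div_pow (n : ℕ) {x : ℝ} (hx : 0 < x) : Real.exp (-x) ≤ (n / x) ^ n := by
  have hfact : (n.factorial : ℝ) ≤ n ^ n := by exact_mod_cast n.factorial_le_pow
  calc Real.exp (-x) = (Real.exp x)⁻¹ := Real.exp_neg x
    _ ≤ (x ^ n / n.factorial)⁻¹ := by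
      gcongr
      exact Real.pow_div_factorial_le_exp x hx.le n
    _ = n.factorial / x ^ n := inv_div _ _
    _ ≤ (n / x) ^ n := by rw [div_pow]; gcongr

theorem norm_sub_le_of_norm_deriv_le {U : Set ℂ} (hU : IsOpen U) {F : ℂ → ℂ}
    (hF : DifferentiableOn ℂ F U) {M : ℝ} (hM : ∀ z ∈ U, ‖deriv F z‖ ≤ M) {z u : ℂ} (hu : ‖u‖ = 1)
    {t : ℝ} (ht : 0 ≤ t) (hseg : ∀ x ∈ Icc 0 t, z + x * u ∈ U) :
    ‖F (z + t * u) - F z‖ ≤ M * t := by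
  have hsub : segment ℝ z (z + t * u) ⊆ U := by
    rw [segment_eq_image']
    rintro _ ⟨x, hx, rfl⟩
    have := hseg (x * t) ⟨mul_nonneg hx.1 ht, mul_le_of_le_one_left ht hx.2⟩
    simpa [mul_assoc] using this
  have := (convex_segment z (z + t * u)).norm_image_sub_le_of_norm_deriv_le
    (fun w hw => hF.differentiableAt (hU.mem_nhds (hsub hw))) (fun w hw => hM w (hsub hw))
    (left_mem_segment ℝ _ _) (right_mem_segment ℝ _ _)
  rwa [add_sub_cancel_left, norm_mul, hu, mul_one, Complex.norm_of_nonneg ht] at this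

theorem exists_mul_log_le (hs0 : 0 < s) (hs1 : s < 1) (hℓ : 0 < ℓ) :
    ∃ C > 0, ∀ (F : ℂ → ℂ) (m δ M t r α : ℝ), Continuous F → DifferentiableOn ℂ F (annulus s) →
      (∀ z ∈ annulus s, ‖F z‖ ≤ m) → (∃ z ∈ annulus s, 3 / 4 * m ≤ ‖F z‖) →
      (r = s ∨ r = 1) → (∀ θ ∈ Icc α (α + ℓ), ‖F (circleMap 0 r θ)‖ ≤ δ) → 0 < δ → δ ≤ m →
      (∀ z ∈ annulus s, ‖deriv F z‖ ≤ M) → t ∈ Icc 0 ((1 - s) / 4) → M * t ≤ m / 4 →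
      t * Real.log (m / δ) ≤ C := by
  obtain ⟨c, hc, h⟩ := exists_two_constants_annulus hs0 hs1 hℓ
  refine ⟨1 / c, by positivity, ?_⟩
  rintro F m δ M t r α hF hd hm ⟨z, hz, hzm⟩ hr hδ hδ0 hδm hM ht hMt
  obtain ⟨u, hu, hseg⟩ := exists_radial_segment hs0 hz
  obtain ⟨hmem, ht1, hts⟩ := hseg t ht
  have hmove : ‖F (z + t * u) - F z‖ ≤ M * t :=
    norm_sub_le_of_norm_deriv_le (isOpen_annulus s) hd hM hu ht.1
      fun x hx => (hseg x ⟨hx.1, hx.2.trans ht.2⟩).1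
  have hhalf : m * (1 / 2) ≤ m * Real.exp (-(c * t * Real.log (m / δ))) := by
    refine le_trans ?_ (h F m δ r α hF hd hm hr hδ hδ0 hδm _ hmem t ht1 hts)
    have := norm_sub_norm_le (F z) (F (z + t * u))
    rw [norm_sub_rev] at this
    linarith
  have hexp := le_of_mul_le_mul_left hhalf (hδ0.trans_le hδm)
  rw [Real.exp_neg, one_div, inv_le_inv₀ two_pos (Real.exp_pos _)] at hexp
  rw [le_div_iff₀ hc]
  linarith [Real.add_one_le_exp (c * t * Real.log (m / δ))]

theorem exists_mul_le_of_exp_neg_le_pow (hs0 : 0 < s) (hs1 : s < 1) (hℓ : 0 < ℓ) (hK : 0 < K)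
    (n : ℕ) :
    ∃ D > 0, ∀ F : ℂ → ℂ, Continuous F → DifferentiableOn ℂ F (annulus s) →
      (∀ z ∈ annulus s, ‖iteratedDeriv (n + 1) F z‖ ≤ K) →
      ∀ η r α Λ : ℝ, 0 < η → η ≤ 1 + K → (∀ z ∈ annulus s, ‖F z‖ ≤ η ^ (n + 1)) →
      (∃ z ∈ annulus s, 3 / 4 * η ^ (n + 1) ≤ ‖F z‖) → (r = s ∨ r = 1) → 0 ≤ Λ →
      (∀ θ ∈ Icc α (α + ℓ), ‖F (circleMap 0 r θ)‖ ≤ Real.exp (-(2 * Λ))) →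
      Real.exp (-Λ) ≤ η ^ (n + 1) → η * Λ ≤ D := by
  obtain ⟨A, hA, hkol⟩ :=
    exists_norm_iteratedDeriv_le_mul_pow hs0 hs1 n (by positivity : 0 < 1 + K) K
  obtain ⟨C, hC, hlog⟩ := exists_mul_log_le hs0 hs1 hℓ
  have hs : 0 < 1 - s := sub_pos.mpr hs1
  set B := A + (1 + K) / (1 - s)
  have hB : 0 < B := by positivity
  refine ⟨4 * B * C, by positivity, ?_⟩
  intro F hF hd hdK η r α Λ hη0 hηK hm hz hr hΛ harc hlarge
  have hη : 0 < η ^ (n + 1) := by positivity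
  have hderiv (z) (hz : z ∈ annulus s) : ‖deriv F z‖ ≤ A * η ^ n := by
    simpa using hkol F hd hdK η hη0 hηK hm 1 (by lia) z hz
  have hstep : η / (4 * B) ≤ (1 - s) / 4 := by
    have : (1 + K) / (1 - s) ≤ B := le_add_of_nonneg_left hA.le
    rw [div_le_iff₀ hs] at this
    rw [div_le_div_iff₀ (by positivity) four_pos]
    linarith
  have hmove : A * η ^ n * (η / (4 * B)) ≤ η ^ (n + 1) / 4 := by
    have : A ≤ B := le_add_of_nonneg_right (by positivity)
    calc A * η ^ n * (η / (4 * B)) ≤ B * η ^ n * (η / (4 * B)) := by gcongr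
      _ = η ^ (n + 1) / 4 := by rw [pow_succ]; field_simp
  have hδ : Real.exp (-(2 * Λ)) ≤ η ^ (n + 1) := (Real.exp_le_exp.mpr (by linarith)).trans hlarge
  have hΛlog : Λ ≤ Real.log (η ^ (n + 1) / Real.exp (-(2 * Λ))) := by
    rw [Real.log_div hη.ne' (Real.exp_pos _).ne', Real.log_exp]
    linarith [(Real.le_log_iff_exp_le hη).mpr hlarge]
  have hC' : η / (4 * B) * Λ ≤ C :=
    (mul_le_mul_of_nonneg_left hΛlog (by positivity)).trans <|
      hlog F _ _ _ _ r α hF hd hm hz hr harc (Real.exp_pos _) hδ hderiv ⟨by positivity, hstep⟩ hmove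
  rw [div_mul_eq_mul_div, div_le_iff₀ (by positivity)] at hC'
  linarith

theorem exists_norm_le_div_pow (hs0 : 0 < s) (hs1 : s < 1) (hℓ : 0 < ℓ) (hK : 0 < K) (n : ℕ) :
    ∃ D > 0, ∀ F : ℂ → ℂ, Continuous F → DifferentiableOn ℂ F (annulus s) →
      (∀ z ∈ annulus s, ‖F z‖ ≤ K) → (∀ z ∈ annulus s, ‖iteratedDeriv (n + 1) F z‖ ≤ K) →
      ∀ r α Λ : ℝ, (r = s ∨ r = 1) → 0 < Λ →
      (∀ θ ∈ Icc α (α + ℓ), ‖F (circleMap 0 r θ)‖ ≤ Real.exp (-(2 * Λ))) →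
      ∀ z ∈ annulus s, ‖F z‖ ≤ (D / Λ) ^ (n + 1) := by
  obtain ⟨D, hD, hbound⟩ := exists_mul_le_of_exp_neg_le_pow hs0 hs1 hℓ hK n
  refine ⟨D + (n + 1 : ℕ), by positivity, fun F hF hd hFK hdK r α Λ hr hΛ harc => ?_⟩
  have : Nonempty (annulus s) := (nonempty_annulus hs0 hs1).to_subtype
  set m := ⨆ z : annulus s, ‖F z‖
  have hm (z) (hz : z ∈ annulus s) : ‖F z‖ ≤ m :=
    le_ciSup (f := fun z : annulus s => ‖F z‖) ⟨K, by rintro _ ⟨z, rfl⟩; exact hFK z z.2⟩ ⟨z, hz⟩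
  have hmK : m ≤ K := ciSup_le fun z => hFK z z.2
  suffices hmD : m ≤ ((D + (n + 1 : ℕ)) / Λ) ^ (n + 1) from fun z hz => (hm z hz).trans hmD
  rcases le_or_gt m (Real.exp (-Λ)) with hsmall | hlarge
  · refine (hsmall.trans (exp_neg_le_div_pow (n + 1) hΛ)).trans ?_
    gcongr
    exact le_add_of_nonneg_left hD.le
  have hm0 : 0 < m := (Real.exp_pos _).trans hlarge
  obtain ⟨η, hη0, hηm⟩ : ∃ η > 0, η ^ (n + 1) = m :=
    ⟨m ^ (((n + 1 : ℕ) : ℝ)⁻¹), Real.rpow_pos_of_pos hm0 _,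
      Real.rpow_inv_natCast_pow hm0.le n.succ_ne_zero⟩
  have hηK : η ≤ 1 + K := by
    by_contra! hgt
    have : η ≤ η ^ (n + 1) := le_self_pow₀ (by linarith) n.succ_ne_zero
    linarith
  obtain ⟨z, hz⟩ := exists_lt_of_lt_ciSup (show 3 / 4 * m < m by linarith)
  rw [← hηm] at hm hz hlarge ⊢
  have hηD : η * Λ ≤ D :=
    hbound F hF hd hdK η r α Λ hη0 hηK hm ⟨z, z.2, hz.le⟩ hr hΛ.le harc hlarge.le
  gcongr
  rw [le_div_iff₀ hΛ]
  exact hηD.trans (le_add_of_nonneg_right (Nat.cast_nonneg _))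

theorem exists_norm_iteratedDeriv_le_div_pow (hs0 : 0 < s) (hs1 : s < 1) (hℓ : 0 < ℓ)
    (hK : 0 < K) (n : ℕ) {L₀ : ℝ} (hL₀ : 0 < L₀) :
    ∃ D > 0, ∀ F : ℂ → ℂ, Continuous F → DifferentiableOn ℂ F (annulus s) →
      (∀ z ∈ annulus s, ‖F z‖ ≤ K) → (∀ z ∈ annulus s, ‖iteratedDeriv (n + 1) F z‖ ≤ K) →
      ∀ r α L : ℝ, (r = s ∨ r = 1) → L₀ ≤ L →
      (∀ θ ∈ Icc α (α + ℓ), ‖F (circleMap 0 r θ)‖ ≤ Real.exp (-(L / 4))) →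
      ∀ i ≤ n + 1, ∀ z ∈ annulus s, ‖iteratedDeriv i F z‖ ≤ D / L ^ (n + 1 - i) := by
  obtain ⟨E, hE, hdecay⟩ := exists_norm_le_div_pow hs0 hs1 hℓ hK n
  obtain ⟨A, hA, hkol⟩ :=
    exists_norm_iteratedDeriv_le_mul_pow hs0 hs1 n (by positivity : 0 < 8 * E / L₀) K
  refine ⟨A * (1 + 8 * E) ^ (n + 1), by positivity, ?_⟩
  intro F hF hd hFK hdK r α L hr hL harc i hi z hz
  have hL0 : 0 < L := hL₀.trans_le hL
  have hpow (z) (hz : z ∈ annulus s) : ‖F z‖ ≤ (8 * E / L) ^ (n + 1) := by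
    convert hdecay F hF hd hFK hdK r α (L / 8) hr (by positivity)
      (fun θ hθ => (harc θ hθ).trans_eq (by ring_nf)) z hz using 2
    field_simp
  calc ‖iteratedDeriv i F z‖ ≤ A * (8 * E / L) ^ (n + 1 - i) :=
        hkol F hd hdK (8 * E / L) (by positivity) (by gcongr) hpow i hi z hz
    _ = A * (8 * E) ^ (n + 1 - i) / L ^ (n + 1 - i) := by rw [div_pow, mul_div_assoc]
    _ ≤ A * (1 + 8 * E) ^ (n + 1) / L ^ (n + 1 - i) := by
        gcongr A * ?_ / _
        calc (8 * E) ^ (n + 1 - i) ≤ (1 + 8 * E) ^ (n + 1 - i) := by gcongr; linarith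
          _ ≤ (1 + 8 * E) ^ (n + 1) := pow_le_pow_right₀ (by linarith) (Nat.sub_le _ _)

end Decay

section Conclusion

variable {s K lam : ℝ}

theorem norm_mem_Icc_of_mem_bdry (hs1 : s ≤ 1) {z : ℂ} (hz : z ∈ bdry s) : ‖z‖ ∈ Icc s 1 := by
  rcases hz with hz | hz <;> rw [mem_sphere_zero_iff_norm] at hz <;> simp [hz, hs1]

theorem exists_norm_le_exp_of_l1Norm_le (hs0 : 0 < s) (hs1 : s < 1) (hlam : 0 < lam) (hK : 0 < K)
    (C : NNReal) :
    ∃ ℓ > 0, ∃ L₀ > 0, ∀ I : Set ℂ, IsConnected I → I ⊆ bdry s →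
      ENNReal.ofReal lam ≤ bdryMeasure s I →
      ∀ f F : ℂ → ℂ, LipschitzWith C F → EqOn f F (annulus s) → (∀ z ∈ bdry s, ‖F z‖ ≤ K) →
      ∀ L ≥ L₀, l1Norm s I f ≤ Real.exp (-L) → ∃ r α, (r = s ∨ r = 1) ∧
        ∀ θ ∈ Icc α (α + ℓ), ‖F (circleMap 0 r θ)‖ ≤ Real.exp (-(L / 4)) := by
  have hmin : 0 < min lam 2 := lt_min hlam two_pos
  have hℓ : Real.pi * min lam 2 ≤ 2 * Real.pi := by
    linarith [mul_le_mul_of_nonneg_left (min_le_right lam 2) Real.pi_pos.le]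
  obtain ⟨A, hA, harc⟩ := exists_norm_sq_le_mul_l1Norm hs0 hs1 (by positivity) hℓ C hK
  refine ⟨Real.pi * min lam 2, by positivity, 2 * A, by positivity, ?_⟩
  intro I hI hIb hμ f F hF hfF hFK L hL hl
  obtain ⟨r, hr, hIr⟩ := exists_subset_sphere hs1 hI.isPreconnected hIb
  have hr0 : 0 < r := by rcases hr with rfl | rfl; exacts [hs0, one_pos]
  rw [bdryMeasure_eq_circleMeasure hs0 hs1 hr hIr] at hμ
  obtain ⟨α, hα⟩ := exists_forall_circleMap_mem hr0 hI hIr hmin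
    ((ENNReal.ofReal_le_ofReal (min_le_left _ _)).trans hμ)
  refine ⟨r, α, hr, fun θ hθ => le_of_pow_le_pow_left₀ two_ne_zero (Real.exp_pos _).le ?_⟩
  calc ‖F (circleMap 0 r θ)‖ ^ 2 ≤ A * l1Norm s I f := harc f F hF hfF hFK r hr I α hα θ hθ
    _ ≤ A * Real.exp (-L) := by gcongr
    _ ≤ Real.exp (L / 2) * Real.exp (-L) := by
      gcongr
      linarith [Real.add_one_le_exp (L / 2)]
    _ = Real.exp (-(L / 4)) ^ 2 := by
      rw [← Real.exp_add, ← Real.exp_nat_mul]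
      ring_nf

theorem exists_norm_iteratedDeriv_le_of_l1Norm_le (hs0 : 0 < s) (hs1 : s < 1) (hlam : 0 < lam)
    (hK : 0 < K) (n : ℕ) :
    ∃ D > 0, ∃ L₀ > 0, ∀ I : Set ℂ, IsConnected I → I ⊆ bdry s →
      ENNReal.ofReal lam ≤ bdryMeasure s I →
      ∀ f : ℂ → ℂ, DifferentiableOn ℂ f (annulus s) →
      (∀ i ≤ n + 1, ∀ z ∈ annulus s, ‖iteratedDeriv i f z‖ ≤ K) →
      ∀ L ≥ L₀, l1Norm s I f ≤ Real.exp (-L) →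
      ∀ i ≤ n + 1, ∀ z ∈ annulus s, ‖iteratedDeriv i f z‖ ≤ D / L ^ (n + 1 - i) := by
  obtain ⟨C, hext⟩ := exists_lipschitzWith_eqOn hs0 K
  obtain ⟨ℓ, hℓ, L₀, hL₀, harc⟩ := exists_norm_le_exp_of_l1Norm_le hs0 hs1 hlam hK C
  obtain ⟨D, hD, hdecay⟩ := exists_norm_iteratedDeriv_le_div_pow hs0 hs1 hℓ hK n hL₀
  refine ⟨D, hD, L₀, hL₀, fun I hI hIb hμ f hf hfK L hL hl i hi z hz => ?_⟩
  obtain ⟨F, hF, hfF⟩ := hext f hf (by simpa using hfK 1 (by lia))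
  have hderiv (i) : EqOn (iteratedDeriv i f) (iteratedDeriv i F) (annulus s) :=
    hfF.iteratedDeriv_of_isOpen (isOpen_annulus s) i
  have hFK (i) (hi : i ≤ n + 1) (z) (hz : z ∈ annulus s) : ‖iteratedDeriv i F z‖ ≤ K :=
    hderiv i hz ▸ hfK i hi z hz
  have hF0 : ∀ z ∈ annulus s, ‖F z‖ ≤ K := by simpa using hFK 0 (Nat.zero_le _)
  obtain ⟨r, α, hr, hα⟩ := harc I hI hIb hμ f F hF hfF
    (fun z hz => norm_le_of_norm_le_annulus hs0 hs1 hF.continuous hF0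
      (norm_mem_Icc_of_mem_bdry hs1.le hz)) L hL hl
  rw [hderiv i hz]
  exact hdecay F hF.continuous (hf.congr hfF.symm) hF0 (hFK _ le_rfl) r α L hr hL hα i hi z hz

theorem hardySobolevNorm_bdry_le (hs0 : 0 < s) (hs1 : s < 1) {j k : ℕ} (hjk : j < k)
    {f : ℂ → ℂ} (hf : MemHardySobolev s k f) {B : ℝ}
    (hB : ∀ i ≤ j, ∀ z ∈ annulus s, ‖iteratedDeriv i f z‖ ≤ B) :
    hardySobolevNorm s j (bdry s) f ≤ ENNReal.ofReal (2 * B) := by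
  refine Finset.sup_le fun i hi => ?_
  have hij : i ≤ j := Finset.mem_range_succ_iff.mp hi
  obtain ⟨z, hz⟩ := nonempty_annulus hs0 hs1
  have hB0 : 0 ≤ B := (norm_nonneg _).trans (hB i hij z hz)
  obtain ⟨C, F, hF, -, hfF⟩ := hf.exists_lipschitzWith_eqOn hs0 (hij.trans_lt hjk)
  have hFB (z) (hz : z ∈ annulus s) : ‖F z‖ ≤ B := hfF hz ▸ hB i hij z hz
  have hbdry (ζ) (hζ : ζ ∈ bdry s) : ‖bdryValue s (iteratedDeriv i f) ζ‖ ≤ B := by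
    rw [bdryValue_eq_of_eqOn hs0 hs1 hF.continuous hfF hζ]
    exact norm_le_of_norm_le_annulus hs0 hs1 hF.continuous hFB (norm_mem_Icc_of_mem_bdry hs1.le hζ)
  rw [two_mul, ENNReal.ofReal_add hB0 hB0]
  exact add_le_add (supNorm_inter_sphere_le (.inl rfl) fun ζ hζ => hbdry ζ (.inl hζ))
    (supNorm_inter_sphere_le (.inr rfl) fun ζ hζ => hbdry ζ (.inr hζ))

theorem le_ofReal_div_abs_log_pow {x : ℝ≥0∞} {a C L₀ : ℝ} (ha : 0 ≤ a) (hL₀ : 0 < L₀)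
    (haL : a < Real.exp (-L₀)) {n : ℕ} (hn : n ≠ 0)
    (h : ∀ L ≥ L₀, a ≤ Real.exp (-L) → x ≤ ENNReal.ofReal (C / L ^ n)) :
    x ≤ ENNReal.ofReal (C / |Real.log a| ^ n) := by
  rcases ha.eq_or_lt with rfl | ha
  · have hlim : Tendsto (fun L : ℝ => ENNReal.ofReal (C / L ^ n)) atTop (𝓝 0) := by
      rw [← ENNReal.ofReal_zero]
      exact ENNReal.tendsto_ofReal (tendsto_const_nhds.div_atTop (tendsto_pow_atTop hn))
    refine (ge_of_tendsto hlim ?_).trans zero_le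
    filter_upwards [eventually_ge_atTop L₀] with L hL using h L hL (Real.exp_pos _).le
  · have hlog : Real.log a < -L₀ := (Real.log_lt_iff_lt_exp ha).mpr haL
    rw [abs_of_neg (by linarith)]
    exact h _ (by linarith) (by rw [neg_neg, Real.exp_log ha])

end Conclusion

end AnnulusHardy

open AnnulusHardy in
theorem corollary3p8_general (s : ℝ) (hs0 : 0 < s) (hs1 : s < 1) (lam : ℝ) (hlam : 0 < lam)
    (K : ℝ) (hK : 0 < K) (j k : ℕ) (hjk : j < k) :
    ∃ C ε : ℝ, 0 < C ∧ 0 < ε ∧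
      ∀ I : Set ℂ, IsConnected I → I ⊆ bdry s → ENNReal.ofReal lam ≤ bdryMeasure s I →
        ∀ f : ℂ → ℂ, MemHardySobolev s k f →
          hardySobolevNorm s k (bdry s) f ≤ ENNReal.ofReal K → l1Norm s I f < ε →
          hardySobolevNorm s j (bdry s) f ≤
            ENNReal.ofReal (C / |Real.log (l1Norm s I f)| ^ (k - j)) := by
  obtain ⟨n, rfl⟩ := Nat.exists_eq_succ_of_ne_zero hjk.ne_bot
  obtain ⟨D, hD, L₀, hL₀, hdecay⟩ :=
    exists_norm_iteratedDeriv_le_of_l1Norm_le hs0 hs1 hlam (div_pos hK hs0) n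
  refine ⟨2 * D, Real.exp (-max L₀ 1), by positivity, Real.exp_pos _, ?_⟩
  intro I hI hIb hμ f hf hfK hl
  have hf0 : DifferentiableOn ℂ f (annulus s) := by simpa using (hf 0 (Nat.zero_le _)).1
  have hderiv (i) (hi : i ≤ n + 1) (z) (hz : z ∈ annulus s) : ‖iteratedDeriv i f z‖ ≤ K / s :=
    norm_iteratedDeriv_le hs0 hs1 hK.le hf hfK n.succ_pos hi hz
  refine le_ofReal_div_abs_log_pow (l1Norm_nonneg s I f) (by positivity) hl
    (Nat.sub_ne_zero_of_lt hjk) fun L hL hle => ?_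
  rw [mul_div_assoc]
  refine hardySobolevNorm_bdry_le hs0 hs1 hjk hf fun i hi z hz => ?_
  refine (hdecay I hI hIb hμ f hf0 hderiv L (le_of_max_le_left hL) hle i (by lia) z hz).trans ?_
  have hL1 : 1 ≤ L := le_of_max_le_right hL
  gcongr

theorem corollary3p8 (s : ℝ) (hs0 : 0 < s) (hs1 : s < 1) (lam : ℝ) (hlam0 : 0 < lam)
    (hlam1 : lam ≤ 1) (K : ℝ) (hK : 0 < K) (j k : ℕ) (hjk : j < k) :
    ∃ C ε : ℝ, 0 < C ∧ 0 < ε ∧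
      ∀ I : Set ℂ, IsConnected I →
        (∃ U : Set ℂ, IsOpen U ∧ I = U ∩ AnnulusHardy.bdry s) →
        AnnulusHardy.bdryMeasure s I = ENNReal.ofReal lam →
        ∀ f : ℂ → ℂ, AnnulusHardy.MemHardySobolev s k f →
          AnnulusHardy.hardySobolevNorm s k (AnnulusHardy.bdry s) f ≤ ENNReal.ofReal K →
          AnnulusHardy.hardySobolevNorm s j I f <
            ENNReal.ofReal
              (Real.exp (-(AnnulusHardy.q0 s / (lam * AnnulusHardy.kernelConst s)))) →
          AnnulusHardy.l1Norm s I f < ε →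
          AnnulusHardy.hardySobolevNorm s j (AnnulusHardy.bdry s) f ≤
            ENNReal.ofReal (C / |Real.log (AnnulusHardy.l1Norm s I f)| ^ (k - j)) := by
  obtain ⟨C, ε, hC, hε, h⟩ := corollary3p8_general s hs0 hs1 lam hlam0 K hK j k hjk
  exact ⟨C, ε, hC, hε, fun I hI ⟨_, _, hIU⟩ hμ f hf hfK _ =>
    h I hI (hIU ▸ Set.inter_subset_right) hμ.ge f hf hfK⟩
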